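/- Let $T$ be a set of events. A \emph{slice} over $T$ is a finite directed acyclic multigraph whose vertices are partitioned into a non-empty center, labeled by elements of $T$, an in-frontier numbered $1,\dots,p$ and an out-frontier numbered $1,\dots,q$ ($p,q\ge 0$), such that each frontier vertex is touched by exactly one edge, which is outgoing for in-frontier vertices and incoming for out-frontier vertices. A slice with exactly one center vertex is a \emph{unit slice}; it is \emph{non-degenerate} if its center vertex is joined to some in-frontier (out-frontier) vertex whenever the in-frontier (out-frontier) is non-empty. A slice is \emph{initial} (\emph{final}) if its in-frontier (out-frontier) is empty. If the out-frontier of $\mathbf S_1$ and the in-frontier of $\mathbf S_2$ have the same size, $\mathbf S_1$ can be composed with $\mathbf S_2$, and $\mathbf S_1\circ \mathbf S_2$ is obtained by gluing, for each $j$, the edge at the $j$-th out-frontier vertex of $\mathbf S_1$ to the edge at the $j$-th in-frontier vertex of $\mathbf S_2$, the glued frontier vertices disappearing (so multiple edges may arise). A \emph{slice graph} $\mathcal{SG}=(\mathcal V,\mathcal E,\mathcal S)$ is a finite directed graph, possibly with loops but without multiple edges, whose vertices $v$ are labeled by non-degenerate unit slices $\mathcal S(v)$ such that $\mathcal S(v_1)$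 can be composed with $\mathcal S(v_2)$ whenever $(v_1,v_2)\in\mathcal E$. Its graph language $\mathcal L_G(\mathcal{SG})$ is the set of DAGs $\mathcal S(v_1)\circ\cdots\circ\mathcal S(v_n)$, where $v_1\cdots v_n$ ($n\ge 1$) ranges over the walks in $\mathcal{SG}$ from a vertex with an initial label to a vertex with a final label, and its partial order language $\mathcal L_{PO}(\mathcal{SG})$ is the set of the $T$-labeled partial orders (up to isomorphism) that are the transitive closures of the DAGs in $\mathcal L_G(\mathcal{SG})$. A \emph{Hasse diagram generator} is a slice graph such that every DAG in its graph language is simple (has no multiple edges) and transitive reduced (has no edge whose deletion leaves the transitive closure unchanged). \textbf{Theorem 2 (Transitive Reduction of General Slice Graphs).} For every slice graph $\mathcal{SG}$ over $T$, possibly generating DAGs with multiple edges, there exists a Hasse diagram generator $\mathcal{HG}$ over $T$ such that $\mathcal L_{PO}(\mathcal{SG})=\mathcal L_{PO}(\mathcal{HG})$. Moreover $\mathcal{HG}$ can be effectively obtained from $\mathcal{SG}$: if the elements of $T$ are effectively encoded (by natural numbers), there is a computable function that maps every finite description of a slice graph $\mathcal{SG}$ over $T$ to a finite description of such an $\mathcal{HG}$.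 -/

import Mathlib

universe u

namespace SliceTheory

/-- A slice over a set `T` of events: a finite acyclic directed multigraph whose vertices are the
disjoint union of an in-frontier (numbered by `Fin ins`), a non-empty center `C` labeled by events,
and an out-frontier (numbered by `Fin outs`).  Every edge leaves the in-frontier or the center and
enters the center or the out-frontier, and each frontier vertex is touched by exactly one edge.
Multiple edges are allowed: edges form a type `E` of their own. -/
structure Slice (T : Type u) where
  C : Type
  E : Type
  finite_C : Finite C
  finite_E : Finite E
  nonempty_C : Nonempty C
  ins : ℕ
  outs : ℕ
  label : C → T
  src : E → Fin ins ⊕ C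
  tgt : E → C ⊕ Fin outs
  in_unique : ∀ i : Fin ins, ∃! e : E, src e = Sum.inl i
  out_unique : ∀ j : Fin outs, ∃! e : E, tgt e = Sum.inr j
  acyclic : ∀ u : C,
    ¬ Relation.TransGen (fun a b => ∃ e : E, src e = Sum.inr a ∧ tgt e = Sum.inl b) u u

namespace Slice

variable {T : Type u}

/-- Some edge goes from the center vertex `a` to the center vertex `b`. -/
def Adj (S : Slice T) (a b : S.C) : Prop :=
  ∃ e : S.E, S.src e = Sum.inr a ∧ S.tgt e = Sum.inl b

/-- Some edge different from `e₀` goes from the center vertex `a` to the center vertex `b`. -/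
def AdjWithout (S : Slice T) (e₀ : S.E) (a b : S.C) : Prop :=
  ∃ e : S.E, e ≠ e₀ ∧ S.src e = Sum.inr a ∧ S.tgt e = Sum.inl b

/-- A slice is initial if its in-frontier is empty. -/
def IsInitial (S : Slice T) : Prop := S.ins = 0

/-- A slice is final if its out-frontier is empty. -/
def IsFinal (S : Slice T) : Prop := S.outs = 0

/-- A unit slice has exactly one center vertex. -/
def IsUnitSlice (S : Slice T) : Prop := ∃ c : S.C, ∀ d : S.C, d = c

/-- A unit slice is non-degenerate if its center vertex is joined to the in-frontier whenever the
in-frontier is not empty, and to the out-frontier whenever the out-frontier is not empty. -/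
def IsNondegenerate (S : Slice T) : Prop :=
  ∀ c : S.C,
    (S.ins ≠ 0 → ∃ (e : S.E) (i : Fin S.ins), S.src e = Sum.inl i ∧ S.tgt e = Sum.inl c) ∧
    (S.outs ≠ 0 → ∃ (e : S.E) (j : Fin S.outs), S.src e = Sum.inr c ∧ S.tgt e = Sum.inr j)

/-- `S₁` can be composed with `S₂`. -/
def Composable (S₁ S₂ : Slice T) : Prop := S₁.outs = S₂.ins

/-- The edges of the composition of two slices: the edges of the first slice that end in its
center, the edges of the second slice that start in its center, and the glued edges, one for each
pair formed by the edge at the `j`-th out-frontier vertex of the first slice and the edge at the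
`j`-th in-frontier vertex of the second. -/
abbrev CompE (S₁ S₂ : Slice T) (h : S₁.Composable S₂) : Type :=
  {e : S₁.E // (S₁.tgt e).isLeft} ⊕ {e : S₂.E // (S₂.src e).isRight} ⊕
    {p : S₁.E × S₂.E // ∃ j : Fin S₁.outs,
      S₁.tgt p.1 = Sum.inr j ∧ S₂.src p.2 = Sum.inl (Fin.cast h j)}

/-- Source of an edge of the composition. -/
def compSrc (S₁ S₂ : Slice T) (h : S₁.Composable S₂) :
    CompE S₁ S₂ h → Fin S₁.ins ⊕ (S₁.C ⊕ S₂.C)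
  | Sum.inl e => Sum.map id Sum.inl (S₁.src e.1)
  | Sum.inr (Sum.inl e) => Sum.inr (Sum.inr ((S₂.src e.1).getRight e.2))
  | Sum.inr (Sum.inr p) => Sum.map id Sum.inl (S₁.src p.1.1)

/-- Target of an edge of the composition. -/
def compTgt (S₁ S₂ : Slice T) (h : S₁.Composable S₂) :
    CompE S₁ S₂ h → (S₁.C ⊕ S₂.C) ⊕ Fin S₂.outs
  | Sum.inl e => Sum.inl (Sum.inl ((S₁.tgt e.1).getLeft e.2))
  | Sum.inr (Sum.inl e) => Sum.map Sum.inr id (S₂.tgt e.1)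
  | Sum.inr (Sum.inr p) => Sum.map Sum.inr id (S₂.tgt p.1.2)

theorem comp_in_unique (S₁ S₂ : Slice T) (h : S₁.Composable S₂) (i : Fin S₁.ins) :
    ∃! e, compSrc S₁ S₂ h e = Sum.inl i := by
  obtain ⟨e, he, hu⟩ := S₁.in_unique i
  have key : ∀ e' : S₁.E, Sum.map id Sum.inl (S₁.src e') =
      (Sum.inl i : Fin S₁.ins ⊕ (S₁.C ⊕ S₂.C)) → e' = e := by
    intro e' h'
    apply hu
    cases hs : S₁.src e' with
    | inl k => simpa [hs] using h'
    | inr c => simp [hs] at h'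
  cases ht : S₁.tgt e with
  | inl c =>
    refine ⟨Sum.inl ⟨e, by simp [ht]⟩, by simp [compSrc, he], ?_⟩
    rintro (⟨e', h'⟩ | ⟨e', h'⟩ | ⟨⟨e', f⟩, j, h1, h2⟩) hh
    · have := key e' hh
      subst this; rfl
    · simp [compSrc] at hh
    · have := key e' hh
      subst this
      simp [ht] at h1
  | inr j =>
    obtain ⟨f, hf, hfu⟩ := S₂.in_unique (Fin.cast h j)
    refine ⟨Sum.inr (Sum.inr ⟨(e, f), j, ht, hf⟩), by simp [compSrc, he], ?_⟩
    rintro (⟨e', h'⟩ | ⟨e', h'⟩ | ⟨⟨e', f'⟩, j', h1, h2⟩) hh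
    · have := key e' hh
      subst this
      simp [ht] at h'
    · simp [compSrc] at hh
    · have := key e' hh
      subst this
      simp only [ht, Sum.inr.injEq] at h1
      subst h1
      have := hfu f' h2
      subst this; rfl

theorem comp_out_unique (S₁ S₂ : Slice T) (h : S₁.Composable S₂) (j : Fin S₂.outs) :
    ∃! e, compTgt S₁ S₂ h e = Sum.inr j := by
  obtain ⟨e, he, hu⟩ := S₂.out_unique j
  have key : ∀ e' : S₂.E, Sum.map Sum.inr id (S₂.tgt e') =
      (Sum.inr j : (S₁.C ⊕ S₂.C) ⊕ Fin S₂.outs) → e' = e := by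
    intro e' h'
    apply hu
    cases hs : S₂.tgt e' with
    | inr k => simpa [hs] using h'
    | inl c => simp [hs] at h'
  cases ht : S₂.src e with
  | inr c =>
    refine ⟨Sum.inr (Sum.inl ⟨e, by simp [ht]⟩), by simp [compTgt, he], ?_⟩
    rintro (⟨e', h'⟩ | ⟨e', h'⟩ | ⟨⟨f, e'⟩, k, h1, h2⟩) hh
    · simp [compTgt] at hh
    · have := key e' hh
      subst this; rfl
    · have := key e' hh
      subst this
      simp [ht] at h2
  | inl i =>
    obtain ⟨f, hf, hfu⟩ := S₁.out_unique (Fin.cast h.symm i)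
    refine ⟨Sum.inr (Sum.inr ⟨(f, e), Fin.cast h.symm i, hf, by rw [ht]; rfl⟩),
      by simp [compTgt, he], ?_⟩
    rintro (⟨e', h'⟩ | ⟨e', h'⟩ | ⟨⟨f', e'⟩, k, h1, h2⟩) hh
    · simp [compTgt] at hh
    · have := key e' hh
      subst this
      simp [ht] at h'
    · have := key e' hh
      subst this
      simp only [ht, Sum.inl.injEq] at h2
      subst h2
      have := hfu f' h1
      subst this; rfl

theorem comp_acyclic (S₁ S₂ : Slice T) (h : S₁.Composable S₂) (u : S₁.C ⊕ S₂.C) :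
    ¬ Relation.TransGen (fun a b => ∃ e, compSrc S₁ S₂ h e = Sum.inr a ∧
      compTgt S₁ S₂ h e = Sum.inl b) u u := by
  let Q : S₁.C ⊕ S₂.C → S₁.C ⊕ S₂.C → Prop := fun x y =>
    match x, y with
    | Sum.inl a, Sum.inl b => Relation.TransGen S₁.Adj a b
    | Sum.inr a, Sum.inr b => Relation.TransGen S₂.Adj a b
    | Sum.inl _, Sum.inr _ => True
    | Sum.inr _, Sum.inl _ => False
  have hQ : ∀ x y z, Q x y → Q y z → Q x z := by
    rintro (x | x) (y | y) (z | z) h1 h2 <;> simp only [Q] at *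
    · exact h1.trans h2
    · exact h1.trans h2
  have hA : ∀ a b, (∃ e, compSrc S₁ S₂ h e = Sum.inr a ∧
      compTgt S₁ S₂ h e = Sum.inl b) → Q a b := by
    rintro a b ⟨e | e | e, h1, h2⟩
    · obtain ⟨e, he⟩ := e
      cases hs : S₁.src e with
      | inl k => simp [compSrc, hs] at h1
      | inr c =>
        cases ht : S₁.tgt e with
        | inr k => simp [ht] at he
        | inl d =>
          simp [compSrc, hs] at h1
          simp [compTgt, ht] at h2
          subst h1 h2
          exact Relation.TransGen.single ⟨e, hs, ht⟩
    · obtain ⟨e, he⟩ := e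
      cases hs : S₂.src e with
      | inl k => simp [hs] at he
      | inr c =>
        cases ht : S₂.tgt e with
        | inr k => simp [compTgt, ht] at h2
        | inl d =>
          simp [compSrc, hs] at h1
          simp [compTgt, ht] at h2
          subst h1 h2
          exact Relation.TransGen.single ⟨e, hs, ht⟩
    · obtain ⟨⟨e, f⟩, he⟩ := e
      cases hs : S₁.src e with
      | inl k => simp [compSrc, hs] at h1
      | inr c =>
        cases ht : S₂.tgt f with
        | inr k => simp [compTgt, ht] at h2
        | inl d =>
          simp [compSrc, hs] at h1
          simp [compTgt, ht] at h2
          subst h1 h2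
          trivial
  have hT : ∀ a b, Relation.TransGen (fun a b => ∃ e, compSrc S₁ S₂ h e = Sum.inr a ∧
      compTgt S₁ S₂ h e = Sum.inl b) a b → Q a b := by
    intro a b hab
    induction hab with
    | single h => exact hA _ _ h
    | tail _ h ih => exact hQ _ _ _ ih (hA _ _ h)
  intro hu
  have := hT _ _ hu
  cases u with
  | inl a => exact S₁.acyclic a this
  | inr a => exact S₂.acyclic a this

/-- The composition of two slices: the edge touching the `j`-th out-frontier vertex of `S₁` is
glued to the edge touching the `j`-th in-frontier vertex of `S₂`; the glued frontier vertices
disappear. -/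
def comp (S₁ S₂ : Slice T) (h : S₁.Composable S₂) : Slice T where
  C := S₁.C ⊕ S₂.C
  E := CompE S₁ S₂ h
  finite_C := by
    have := S₁.finite_C
    have := S₂.finite_C
    infer_instance
  finite_E := by
    have := S₁.finite_E
    have := S₂.finite_E
    infer_instance
  nonempty_C := S₁.nonempty_C.map Sum.inl
  ins := S₁.ins
  outs := S₂.outs
  label := Sum.elim S₁.label S₂.label
  src := compSrc S₁ S₂ h
  tgt := compTgt S₁ S₂ h
  in_unique := comp_in_unique S₁ S₂ h
  out_unique := comp_out_unique S₁ S₂ h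
  acyclic := comp_acyclic S₁ S₂ h

/-- `IsCompositionOf w H`: the non-empty string `w = S₁ S₂ ⋯ Sₙ` of consecutively composable slices
has the composition `H = (⋯(S₁ ∘ S₂) ∘ ⋯) ∘ Sₙ`. -/
inductive IsCompositionOf : List (Slice T) → Slice T → Prop
  | single (S : Slice T) : IsCompositionOf [S] S
  | snoc {w : List (Slice T)} {H S : Slice T} (hw : IsCompositionOf w H) (h : H.Composable S) :
      IsCompositionOf (w ++ [S]) (H.comp S h)

/-- A DAG is simple if no two distinct edges have the same source and the same target. -/
def IsSimple (H : Slice T) : Prop :=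
  ∀ e e' : H.E, H.src e = H.src e' → H.tgt e = H.tgt e' → e = e'

/-- An edge is superfluous if its deletion does not change the transitive closure. -/
def IsSuperfluous (H : Slice T) (e : H.E) : Prop :=
  ∀ a b : H.C, Relation.TransGen (H.AdjWithout e) a b ↔ Relation.TransGen H.Adj a b

/-- A DAG is transitive reduced if it has no superfluous edge. -/
def IsTransitiveReduced (H : Slice T) : Prop := ∀ e : H.E, ¬ H.IsSuperfluous e

end Slice

/-- A partial order whose elements are labeled by events. -/
structure LabeledPO (T : Type u) where
  carrier : Type
  order : PartialOrder carrier
  label : carrier → T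

/-- Isomorphism of labeled partial orders: a label preserving order isomorphism. -/
def LabeledPO.Isomorphic {T : Type u} (P Q : LabeledPO T) : Prop :=
  ∃ φ : P.carrier ≃ Q.carrier,
    (∀ x, Q.label (φ x) = P.label x) ∧
    ∀ x y, Q.order.le (φ x) (φ y) ↔ P.order.le x y

/-- The labeled partial order on the center vertices induced by a DAG, that is, its transitive
closure: `a < b` iff there is a directed path with at least one edge from `a` to `b`. -/
def Slice.closure {T : Type u} (H : Slice T) : LabeledPO T where
  carrier := H.C
  order :=
    { le := Relation.ReflTransGen H.Adj
      le_refl := fun _ => Relation.ReflTransGen.refl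
      le_trans := fun _ _ _ h₁ h₂ => h₁.trans h₂
      le_antisymm := fun a b h₁ h₂ => by
        rcases Relation.reflTransGen_iff_eq_or_transGen.1 h₁ with h | h
        · exact h.symm
        · exact absurd (h.trans_left h₂) (H.acyclic a) }
  label := H.label

/-- A slice graph over the set of events `T`: a finite directed graph, possibly with loops but
without multiple edges, whose vertices are labeled with non-degenerate unit slices in such a way
that the slices of adjacent vertices can be composed. -/
structure SliceGraph (T : Type u) where
  V : Type
  finite_V : Finite V
  Edge : V → V → Prop
  slice : V → Slice T
  unit : ∀ v, (slice v).IsUnitSlice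
  nondegenerate : ∀ v, (slice v).IsNondegenerate
  composable : ∀ v w, Edge v w → (slice v).Composable (slice w)

namespace SliceGraph

variable {T : Type u}

/-- The slice language: label strings of walks from an initial to a final vertex. -/
def sliceLanguage (G : SliceGraph T) : Set (List (Slice T)) :=
  {s | ∃ (w : List G.V) (hw : w ≠ []),
      w.IsChain G.Edge ∧
      (G.slice (w.head hw)).IsInitial ∧
      (G.slice (w.getLast hw)).IsFinal ∧
      s = w.map G.slice}

/-- The graph language: the compositions of the strings of the slice language.  They are DAGs,
regarded as slices with empty frontiers. -/
def graphLanguage (G : SliceGraph T) : Set (Slice T) :=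
  {H | ∃ s ∈ G.sliceLanguage, Slice.IsCompositionOf s H}

/-- The partial order language: all labeled partial orders that are, up to isomorphism, the
transitive closure of a DAG of the graph language. -/
def poLanguage (G : SliceGraph T) : Set (LabeledPO T) :=
  {P | ∃ H ∈ G.graphLanguage, P.Isomorphic H.closure}

/-- A Hasse diagram generator is a slice graph that generates only simple and transitive reduced
DAGs. -/
def IsHasseDiagramGenerator (G : SliceGraph T) : Prop :=
  ∀ H ∈ G.graphLanguage, H.IsSimple ∧ H.IsTransitiveReduced

end SliceGraph

/-- Finite data for a unit slice: the event of the center vertex, the sizes of the in- and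
out-frontier, and the list of edges.  In the source (target) of an edge, `some i` stands for the
`i`-th vertex of the in-frontier (out-frontier) and `none` for the center vertex. -/
abbrev UnitSliceCode (T : Type u) : Type u := T × ℕ × ℕ × List (Option ℕ × Option ℕ)

/-- The code describes the unit slice `S`. -/
def UnitSliceCode.Describes {T : Type u} (c : UnitSliceCode T) (S : Slice T) : Prop :=
  S.IsUnitSlice ∧ (∀ x : S.C, S.label x = c.1) ∧ S.ins = c.2.1 ∧ S.outs = c.2.2.1 ∧
  ∃ b : Fin c.2.2.2.length ≃ S.E, ∀ k,
    c.2.2.2.get k =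
      (Sum.elim (fun i => some i.val) (fun _ => none) (S.src (b k)),
       Sum.elim (fun _ => none) (fun j => some j.val) (S.tgt (b k)))

/-- Finite data for a slice graph: the list of the slices labeling its vertices and the list of its
edges, as pairs of positions in the first list. -/
abbrev SliceGraphCode (T : Type u) : Type u := List (UnitSliceCode T) × List (ℕ × ℕ)

/-- The code describes the slice graph `G`. -/
def SliceGraphCode.Describes {T : Type u} (c : SliceGraphCode T) (G : SliceGraph T) : Prop :=
  ∃ b : Fin c.1.length ≃ G.V,
    (∀ k, UnitSliceCode.Describes (c.1.get k) (G.slice (b k))) ∧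
    ∀ k l, G.Edge (b k) (b l) ↔ ((k : ℕ), (l : ℕ)) ∈ c.2

/-- Every unit slice is described by some code. -/
theorem exists_unitSliceCode {T : Type u} (S : Slice T) (h : S.IsUnitSlice) :
    ∃ c : UnitSliceCode T, UnitSliceCode.Describes c S := by
  classical
  obtain ⟨x, hx⟩ := h
  have := S.finite_E
  obtain ⟨n, ⟨e⟩⟩ := Finite.exists_equiv_fin S.E
  let L : List (Option ℕ × Option ℕ) := List.ofFn fun k : Fin n =>
      (Sum.elim (fun i => some i.val) (fun _ => none) (S.src (e.symm k)),
       Sum.elim (fun _ => none) (fun j => some j.val) (S.tgt (e.symm k)))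
  refine ⟨(S.label x, S.ins, S.outs, L), ⟨x, hx⟩, fun y => by rw [hx y], rfl, rfl,
    (finCongr (by simp [L])).trans e.symm, fun k => ?_⟩
  simp [L]; exact ⟨rfl, rfl⟩

/-- Every slice graph is described by some code. -/
theorem exists_sliceGraphCode {T : Type u} (G : SliceGraph T) : ∃ c : SliceGraphCode T, c.Describes G := by
  classical
  have := G.finite_V
  obtain ⟨n, ⟨e⟩⟩ := Finite.exists_equiv_fin G.V
  choose c hc using fun v => exists_unitSliceCode (G.slice v) (G.unit v)
  let A : Finset (Fin n × Fin n) := Finset.univ.filter fun p => G.Edge (e.symm p.1) (e.symm p.2)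
  refine ⟨(List.ofFn fun k => c (e.symm k), A.toList.map fun p => (p.1.val, p.2.val)),
    (finCongr (by simp)).trans e.symm, fun k => ?_, fun k l => ?_⟩
  · have := hc (e.symm (Fin.cast (by simp) k)); simp; exact this
  · simp only [Equiv.trans_apply, List.mem_map, Finset.mem_toList, A, Finset.mem_filter, Finset.mem_univ, true_and, Prod.mk.injEq, Prod.exists]
    constructor
    · intro h; exact ⟨_, _, h, by simp, by simp⟩
    · rintro ⟨a, b, h, h1, h2⟩
      have e1 : (finCongr (by simp) k) = a := Fin.ext (by simpa using h1.symm)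
      have e2 : (finCongr (by simp) l) = b := Fin.ext (by simpa using h2.symm)
      rw [e1, e2]; exact h

end SliceTheory

/-! Compose the slices of a walk one at a time. Each unit slice adds one vertex c, and no edge leads
from c back to an earlier vertex, so neither the order nor the covering relation among the earlier
vertices changes. The vertex c covers exactly the maximal elements among the sources of the edges
that end in c. The Hasse diagram is therefore obtained by deleting every edge into c whose source is
not maximal among these and, of parallel edges, all but the one with the least frontier index.

Which edges into c survive depends only on how the sources of the edges crossing the frontier
compare. This is finite information: a preorder R on the frontier indices (not an order, since
several edges may share a source). It is carried forward across a slice by `step`. Survival,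
however, is decided only where an edge ends, while all slices that the edge crosses earlier must
already omit it if it is to be deleted. Hence a vertex of the generator also guesses the set K of
surviving out-frontier edges, and `back` computes from it the surviving in-frontier edges. The
vertices of the generator are triples of an old vertex, an R and a K; they are joined when the old
vertices are, R agrees with `step` and K agrees with `back`. The invariant `Slice.Reduces` says that
along a walk of the generator the composition is the Hasse diagram of the composition along the
projected walk; `Slice.Reduces.comp` extends it by one slice.

Deletion might detach a center from a frontier, so only the vertices satisfying `Good` are admitted.
No walk is lost by this: by backward induction (`MaxKept.back`) every maximal class of sources at a
frontier retains an edge, and the newest vertex is always maximal (`MaxKept.good`). In the other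
direction, `Good` prevents a non-empty frontier from becoming empty, so initial and final vertices
project to initial and final ones.

Every ingredient is a search through explicitly bounded finite lists, so the construction is
primitive recursive on codes. -/

namespace SliceTheory

/-! ### Forward and backward annotations of an edge list -/

/-- The list of the edges of a unit slice, as in `UnitSliceCode`. -/
abbrev EdgeList : Type := List (Option ℕ × Option ℕ)

/-- All pairs of numbers below `n`. -/
def pairs (n : ℕ) : List (ℕ × ℕ) := (List.range n).flatMap fun i => (List.range n).map (Prod.mk i)

@[simp] theorem mem_pairs {n : ℕ} {x : ℕ × ℕ} : x ∈ pairs n ↔ x.1 < n ∧ x.2 < n := by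
  obtain ⟨a, b⟩ := x
  simp [pairs]

/-- All sublists of a list. -/
def subs {α : Type*} (l : List α) : List (List α) :=
  l.foldr (fun a acc => acc ++ acc.map (List.cons a)) [[]]

@[simp] theorem mem_subs {α : Type*} {l s : List α} : s ∈ subs l ↔ s.Sublist l := by
  induction l generalizing s with
  | nil => simp [subs]
  | cons a l ih =>
    have : subs (a :: l) = subs l ++ (subs l).map (List.cons a) := rfl
    rw [this, List.mem_append, List.mem_map, List.sublist_cons_iff, ih]
    simp only [ih]
    constructor
    · rintro (h | ⟨r, h, rfl⟩)
      · exact Or.inl h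
      · exact Or.inr ⟨r, rfl, h⟩
    · rintro (h | ⟨r, rfl, h⟩)
      · exact Or.inl h
      · exact Or.inr ⟨r, h, rfl⟩

/-- An edge from the `i`-th in-frontier vertex to the center is kept if, in the preorder `R` of the
sources, its source is maximal among the sources of such edges, and `i` is least in its class. -/
def KeepIn (L : EdgeList) (R : List (ℕ × ℕ)) (i : ℕ) : Prop :=
  (some i, none) ∈ L ∧
    ∀ r ∈ R, r.1 = i → (some r.2, none) ∈ L → (r.2, r.1) ∈ R ∧ r.1 ≤ r.2

instance (L : EdgeList) (R : List (ℕ × ℕ)) : DecidablePred (KeepIn L R) := fun _ => by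
  unfold KeepIn; infer_instance

/-- The in-frontier edges to be kept, given the out-frontier edges `K` to be kept. -/
def back (p : ℕ) (L : EdgeList) (R : List (ℕ × ℕ)) (K : List ℕ) : List ℕ :=
  (List.range p).filter fun i => decide (KeepIn L R i ∨ ∃ j ∈ K, (some i, some j) ∈ L)

/-- The preorder of the sources of the out-frontier edges, given that of the in-frontier edges. -/
def StepRel (L : EdgeList) (R : List (ℕ × ℕ)) (x : ℕ × ℕ) : Prop :=
  ((none, some x.1) ∈ L ∧ (none, some x.2) ∈ L) ∨
    ∃ r ∈ R, (some r.1, some x.1) ∈ L ∧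
      ((some r.2, some x.2) ∈ L ∨ ((none, some x.2) ∈ L ∧ (some r.2, none) ∈ L))

instance (L : EdgeList) (R : List (ℕ × ℕ)) : DecidablePred (StepRel L R) := fun _ => by
  unfold StepRel; infer_instance

def step (q : ℕ) (L : EdgeList) (R : List (ℕ × ℕ)) : List (ℕ × ℕ) :=
  (pairs q).filter fun x => decide (StepRel L R x)

/-- The edges kept by the restriction to the frontier vertices in `K` and `K'`. -/
def restrict (L : EdgeList) (K K' : List ℕ) : EdgeList :=
  (L.filter fun x => decide ((∀ i ∈ x.1.toList, i ∈ K) ∧ ∀ j ∈ x.2.toList, j ∈ K')).map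
    fun x => (x.1.map fun i => K.idxOf i, x.2.map fun j => K'.idxOf j)

/-- The list `L` is the edge list of a unit slice with frontiers of sizes `p` and `q`. -/
structure ValidEdges (p q : ℕ) (L : EdgeList) : Prop where
  nodup : L.Nodup
  center : (none, none) ∉ L
  fst_lt : ∀ {i b}, (some i, b) ∈ L → i < p
  snd_lt : ∀ {a j}, (a, some j) ∈ L → j < q
  exists_in : ∀ {i}, i < p → ∃ b, (some i, b) ∈ L
  exists_out : ∀ {j}, j < q → ∃ a, (a, some j) ∈ L
  in_unique : ∀ {i b b'}, (some i, b) ∈ L → (some i, b') ∈ L → b = b'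
  out_unique : ∀ {j a a'}, (a, some j) ∈ L → (a', some j) ∈ L → a = a'

/-- `R` is a preorder on the numbers below `p`. -/
structure PreorderBelow (p : ℕ) (R : List (ℕ × ℕ)) : Prop where
  lt : ∀ {i j}, (i, j) ∈ R → i < p ∧ j < p
  refl : ∀ {i}, i < p → (i, i) ∈ R
  trans : ∀ {i j k}, (i, j) ∈ R → (j, k) ∈ R → (i, k) ∈ R

/-! ### Computation rules for `back`, `restrict` and `step` -/

section
variable {p q : ℕ} {L : EdgeList} {R : List (ℕ × ℕ)} {K K' : List ℕ}

theorem back_sublist : (back p L R K').Sublist (List.range p) := List.filter_sublist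

theorem back_nodup : (back p L R K').Nodup := List.nodup_range.sublist back_sublist

theorem mem_back {i : ℕ} :
    i ∈ back p L R K' ↔ i < p ∧ (KeepIn L R i ∨ ∃ j ∈ K', (some i, some j) ∈ L) := by
  simp [back]

/-- An edge that merely crosses the slice has one fate, recorded at both frontiers; its source and
target in the slice cannot disagree about it. -/
theorem ValidEdges.mem_back_of_pass (h : ValidEdges p q L) {i j : ℕ} (hij : (some i, some j) ∈ L) :
    i ∈ back p L R K' ↔ j ∈ K' := by
  rw [mem_back]
  constructor
  · rintro ⟨-, hk | ⟨j', hj', h'⟩⟩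
    · exact absurd (h.in_unique hk.1 hij) (by simp)
    · have := h.in_unique hij h'
      simp only [Option.some.injEq] at this
      exact this ▸ hj'
  · exact fun hj => ⟨h.fst_lt hij, Or.inr ⟨j, hj, hij⟩⟩

theorem ValidEdges.mem_back_of_in (h : ValidEdges p q L) {i : ℕ} (hi : (some i, none) ∈ L) :
    i ∈ back p L R K' ↔ KeepIn L R i := by
  rw [mem_back]
  constructor
  · rintro ⟨-, hk | ⟨j', hj', h'⟩⟩
    · exact hk
    · exact absurd (h.in_unique hi h') (by simp)
  · exact fun hk => ⟨h.fst_lt hi, Or.inl hk⟩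

theorem mem_restrict {x : Option ℕ × Option ℕ} : x ∈ restrict L K K' ↔
    ∃ y ∈ L, (∀ i, y.1 = some i → i ∈ K) ∧ (∀ j, y.2 = some j → j ∈ K') ∧
      x = (y.1.map fun i => K.idxOf i, y.2.map fun j => K'.idxOf j) := by
  simp only [restrict, List.mem_map, List.mem_filter, decide_eq_true_eq, Option.mem_toList]
  constructor
  · rintro ⟨y, ⟨h1, h2, h3⟩, rfl⟩
    exact ⟨y, h1, h2, h3, rfl⟩
  · rintro ⟨y, h1, h2, h3, rfl⟩
    exact ⟨y, ⟨h1, h2, h3⟩, rfl⟩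

/-- Dictionary between the old number `i` of a frontier vertex and its new number `j` after the
frontier has been restricted to `K`. -/
theorem getElem?_eq_some_iff_idxOf (hK : K.Nodup) {i j : ℕ} :
    K[j]? = some i ↔ i ∈ K ∧ K.idxOf i = j := by
  rw [List.getElem?_eq_some_iff]
  constructor
  · rintro ⟨h, rfl⟩
    exact ⟨List.getElem_mem h, hK.idxOf_getElem j h⟩
  · rintro ⟨h, rfl⟩
    exact ⟨List.idxOf_lt_length_of_mem h, List.getElem_idxOf _⟩

theorem mem_restrict_in (hK : K.Nodup) {j : ℕ} :
    (some j, none) ∈ restrict L K K' ↔ ∃ i, K[j]? = some i ∧ (some i, none) ∈ L := by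
  simp only [mem_restrict, getElem?_eq_some_iff_idxOf hK]
  constructor
  · rintro ⟨⟨_ | i, _ | b⟩, h1, h2, h3, h4⟩ <;> simp at h4
    exact ⟨i, ⟨h2 i rfl, h4.symm⟩, h1⟩
  · rintro ⟨i, ⟨h1, rfl⟩, h⟩
    exact ⟨_, h, by simpa using h1, by simp, rfl⟩

theorem mem_restrict_out (hK' : K'.Nodup) {j : ℕ} :
    (none, some j) ∈ restrict L K K' ↔ ∃ i, K'[j]? = some i ∧ (none, some i) ∈ L := by
  simp only [mem_restrict, getElem?_eq_some_iff_idxOf hK']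
  constructor
  · rintro ⟨⟨_ | a, _ | i⟩, h1, h2, h3, h4⟩ <;> simp at h4
    exact ⟨i, ⟨h3 i rfl, h4.symm⟩, h1⟩
  · rintro ⟨i, ⟨h1, rfl⟩, h⟩
    exact ⟨_, h, by simp, by simpa using h1, rfl⟩

theorem mem_restrict_pass (hK : K.Nodup) (hK' : K'.Nodup) {a b : ℕ} :
    (some a, some b) ∈ restrict L K K' ↔
      ∃ i j, K[a]? = some i ∧ K'[b]? = some j ∧ (some i, some j) ∈ L := by
  simp only [mem_restrict, getElem?_eq_some_iff_idxOf hK, getElem?_eq_some_iff_idxOf hK']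
  constructor
  · rintro ⟨⟨_ | i, _ | j⟩, h1, h2, h3, h4⟩ <;> simp at h4
    exact ⟨i, j, ⟨h2 i rfl, h4.1.symm⟩, ⟨h3 j rfl, h4.2.symm⟩, h1⟩
  · rintro ⟨i, j, ⟨h1, rfl⟩, ⟨h2, rfl⟩, h⟩
    exact ⟨_, h, by simpa using h1, by simpa using h2, rfl⟩

theorem mem_restrict_center : (none, none) ∈ restrict L K K' ↔ (none, none) ∈ L := by
  simp only [mem_restrict]
  constructor
  · rintro ⟨⟨_ | i, _ | j⟩, h1, h2, h3, h4⟩ <;> simp at h4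
    exact h1
  · exact fun h => ⟨_, h, by simp, by simp, rfl⟩

/-- Taking `back` as the in-frontier is what makes this work: a crossing edge loses either both of
its endpoints or neither, so every surviving frontier vertex still has its edge. -/
theorem ValidEdges.restrict (h : ValidEdges p q L) (hK' : K'.Sublist (List.range q)) :
    ValidEdges (back p L R K').length K'.length (restrict L (back p L R K') K') := by
  have n1 : (back p L R K').Nodup := back_nodup
  have n2 : K'.Nodup := List.nodup_range.sublist hK'
  have hi : ∀ {a b i : ℕ}, (back p L R K')[a]? = some i → (back p L R K')[b]? = some i → a = b := by
    intro a b i ha hb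
    rw [getElem?_eq_some_iff_idxOf n1] at ha hb
    exact ha.2.symm.trans hb.2
  have ho : ∀ {a b i : ℕ}, K'[a]? = some i → K'[b]? = some i → a = b := by
    intro a b i ha hb
    rw [getElem?_eq_some_iff_idxOf n2] at ha hb
    exact ha.2.symm.trans hb.2
  refine ⟨?_, ?_, ?_, ?_, ?_, ?_, ?_, ?_⟩
  · refine List.Nodup.map_on ?_ (h.nodup.filter _)
    -- `idxOf` is injective only on members of `K`, which is what the filter in `restrict`
    -- guarantees.
    have inj : ∀ {K : List ℕ} {a b : Option ℕ}, (∀ i, a = some i → i ∈ K) →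
        (∀ i, b = some i → i ∈ K) →
        a.map (fun i => K.idxOf i) = b.map (fun i => K.idxOf i) → a = b := by
      rintro K (_ | a) (_ | b) ha hb hab <;> simp at hab ⊢
      exact (List.idxOf_inj (ha a rfl)).1 hab
    intro x hx y hy hxy
    simp only [List.mem_filter, decide_eq_true_eq, Option.mem_toList] at hx hy
    simp only [Prod.mk.injEq] at hxy
    exact Prod.ext (inj hx.2.1 hy.2.1 hxy.1) (inj hx.2.2 hy.2.2 hxy.2)
  · rw [mem_restrict_center]; exact h.center
  · rintro i (_ | b) hx
    · obtain ⟨k, hk, -⟩ := (mem_restrict_in n1).1 hx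
      exact (List.getElem?_eq_some_iff.1 hk).1
    · obtain ⟨k, -, hk, -⟩ := (mem_restrict_pass n1 n2).1 hx
      exact (List.getElem?_eq_some_iff.1 hk).1
  · rintro (_ | a) j hx
    · obtain ⟨k, hk, -⟩ := (mem_restrict_out n2).1 hx
      exact (List.getElem?_eq_some_iff.1 hk).1
    · obtain ⟨-, k, -, hk, -⟩ := (mem_restrict_pass n1 n2).1 hx
      exact (List.getElem?_eq_some_iff.1 hk).1
  · intro a ha
    have e : (back p L R K')[a]? = some (back p L R K')[a] := List.getElem?_eq_getElem ha
    have hm : (back p L R K')[a] ∈ back p L R K' := List.getElem_mem ha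
    generalize (back p L R K')[a] = i at e hm
    obtain ⟨_ | j, hb⟩ := h.exists_in (mem_back.1 hm).1
    · exact ⟨none, (mem_restrict_in n1).2 ⟨i, e, hb⟩⟩
    · exact ⟨some (K'.idxOf j), (mem_restrict_pass n1 n2).2 ⟨i, j, e,
        (getElem?_eq_some_iff_idxOf n2).2 ⟨(h.mem_back_of_pass hb).1 hm, rfl⟩, hb⟩⟩
  · intro a ha
    have e : K'[a]? = some K'[a] := List.getElem?_eq_getElem ha
    have hm : K'[a] ∈ K' := List.getElem_mem ha
    generalize K'[a] = j at e hm
    obtain ⟨_ | i, hb⟩ := h.exists_out (List.mem_range.1 (hK'.subset hm))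
    · exact ⟨none, (mem_restrict_out n2).2 ⟨j, e, hb⟩⟩
    · exact ⟨some ((back p L R K').idxOf i), (mem_restrict_pass n1 n2).2 ⟨i, j,
        (getElem?_eq_some_iff_idxOf n1).2 ⟨(h.mem_back_of_pass hb).2 hm, rfl⟩, e, hb⟩⟩
  · rintro i (_ | b) (_ | b') hx hy
    · rfl
    · obtain ⟨k, hk, h1⟩ := (mem_restrict_in n1).1 hx
      obtain ⟨k', l, hk', -, h2⟩ := (mem_restrict_pass n1 n2).1 hy
      obtain rfl : k = k' := by simpa [hk] using hk'
      exact absurd (h.in_unique h1 h2) (by simp)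
    · obtain ⟨k, hk, h1⟩ := (mem_restrict_in n1).1 hy
      obtain ⟨k', l, hk', -, h2⟩ := (mem_restrict_pass n1 n2).1 hx
      obtain rfl : k = k' := by simpa [hk] using hk'
      exact absurd (h.in_unique h1 h2) (by simp)
    · obtain ⟨k, l, hk, hl, h1⟩ := (mem_restrict_pass n1 n2).1 hx
      obtain ⟨k', l', hk', hl', h2⟩ := (mem_restrict_pass n1 n2).1 hy
      obtain rfl : k = k' := by simpa [hk] using hk'
      obtain rfl : l = l' := by simpa using h.in_unique h1 h2
      rw [ho hl hl']
  · rintro i (_ | b) (_ | b') hx hy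
    · rfl
    · obtain ⟨k, hk, h1⟩ := (mem_restrict_out n2).1 hx
      obtain ⟨l, k', -, hk', h2⟩ := (mem_restrict_pass n1 n2).1 hy
      obtain rfl : k = k' := by simpa [hk] using hk'
      exact absurd (h.out_unique h1 h2) (by simp)
    · obtain ⟨k, hk, h1⟩ := (mem_restrict_out n2).1 hy
      obtain ⟨l, k', -, hk', h2⟩ := (mem_restrict_pass n1 n2).1 hx
      obtain rfl : k = k' := by simpa [hk] using hk'
      exact absurd (h.out_unique h1 h2) (by simp)
    · obtain ⟨l, k, hl, hk, h1⟩ := (mem_restrict_pass n1 n2).1 hx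
      obtain ⟨l', k', hl', hk', h2⟩ := (mem_restrict_pass n1 n2).1 hy
      obtain rfl : k = k' := by simpa [hk] using hk'
      obtain rfl : l = l' := by simpa using h.out_unique h1 h2
      rw [hi hl hl']

theorem step_sublist : (step q L R).Sublist (pairs q) := List.filter_sublist

theorem ValidEdges.mem_step_out_out (h : ValidEdges p q L) {i j : ℕ} (hi : (none, some i) ∈ L)
    (hj : (none, some j) ∈ L) : (i, j) ∈ step q L R := by
  simp only [step, List.mem_filter, mem_pairs, decide_eq_true_eq]
  exact ⟨⟨h.snd_lt hi, h.snd_lt hj⟩, Or.inl ⟨hi, hj⟩⟩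

/-- The center is newer than the source of any crossing edge, and nothing leads back to older
vertices. -/
theorem ValidEdges.not_mem_step_out_pass (h : ValidEdges p q L) {i j k : ℕ}
    (hi : (none, some i) ∈ L) (hj : (some k, some j) ∈ L) : (i, j) ∉ step q L R := by
  simp only [step, List.mem_filter, mem_pairs, decide_eq_true_eq, not_and]
  rintro - (⟨-, h2⟩ | ⟨r, -, h1, -⟩)
  · exact absurd (h.out_unique hj h2) (by simp)
  · exact absurd (h.out_unique hi h1) (by simp)

theorem ValidEdges.mem_step_pass_pass (h : ValidEdges p q L) {i j a b : ℕ}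
    (hi : (some a, some i) ∈ L) (hj : (some b, some j) ∈ L) :
    (i, j) ∈ step q L R ↔ (a, b) ∈ R := by
  simp only [step, List.mem_filter, mem_pairs, decide_eq_true_eq]
  constructor
  · rintro ⟨-, ⟨-, h2⟩ | ⟨r, hr, h1, h2 | ⟨h2, -⟩⟩⟩
    · exact absurd (h.out_unique hj h2) (by simp)
    · obtain rfl : a = r.1 := by simpa using h.out_unique hi h1
      obtain rfl : b = r.2 := by simpa using h.out_unique hj h2
      exact hr
    · exact absurd (h.out_unique hj h2) (by simp)
  · exact fun hr => ⟨⟨h.snd_lt hi, h.snd_lt hj⟩, Or.inr ⟨_, hr, hi, Or.inl hj⟩⟩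

/-- An older source lies below the center exactly when it lies below the source of some edge that
ends in the center. -/
theorem ValidEdges.mem_step_pass_out (h : ValidEdges p q L) {i j a : ℕ}
    (hi : (some a, some i) ∈ L) (hj : (none, some j) ∈ L) :
    (i, j) ∈ step q L R ↔ ∃ b, (some b, none) ∈ L ∧ (a, b) ∈ R := by
  simp only [step, List.mem_filter, mem_pairs, decide_eq_true_eq]
  constructor
  · rintro ⟨-, ⟨h2, -⟩ | ⟨r, hr, h1, h2 | ⟨-, h2⟩⟩⟩
    · exact absurd (h.out_unique hi h2) (by simp)
    · exact absurd (h.out_unique hj h2) (by simp)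
    · obtain rfl : a = r.1 := by simpa using h.out_unique hi h1
      exact ⟨_, h2, hr⟩
  · rintro ⟨b, hb, hr⟩
    exact ⟨⟨h.snd_lt hi, h.snd_lt hj⟩, Or.inr ⟨_, hr, hi, Or.inr ⟨hj, hb⟩⟩⟩

theorem lt_of_mem_step {i j : ℕ} (h : (i, j) ∈ step q L R) : i < q ∧ j < q := by
  simpa using step_sublist.subset h

theorem PreorderBelow.step (hR : PreorderBelow p R) (h : ValidEdges p q L) :
    PreorderBelow q (step q L R) := by
  refine ⟨lt_of_mem_step, ?_, ?_⟩
  · intro j hj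
    obtain ⟨_ | i, hi⟩ := h.exists_out hj
    · exact h.mem_step_out_out hi hi
    · exact (h.mem_step_pass_pass hi hi).2 (hR.refl (h.fst_lt hi))
  · intro i j k hij hjk
    obtain ⟨_ | a, ha⟩ := h.exists_out (lt_of_mem_step hij).1 <;>
    obtain ⟨_ | b, hb⟩ := h.exists_out (lt_of_mem_step hij).2 <;>
    obtain ⟨_ | c, hc⟩ := h.exists_out (lt_of_mem_step hjk).2
    · exact h.mem_step_out_out ha hc
    · exact absurd hjk (h.not_mem_step_out_pass hb hc)
    · exact h.mem_step_out_out ha hc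
    · exact absurd hij (h.not_mem_step_out_pass ha hb)
    · rw [h.mem_step_pass_out ha hb] at hij
      exact (h.mem_step_pass_out ha hc).2 hij
    · exact absurd hjk (h.not_mem_step_out_pass hb hc)
    · rw [h.mem_step_pass_pass ha hb] at hij
      rw [h.mem_step_pass_out hb hc] at hjk
      obtain ⟨d, hd, hbd⟩ := hjk
      exact (h.mem_step_pass_out ha hc).2 ⟨d, hd, hR.trans hij hbd⟩
    · rw [h.mem_step_pass_pass ha hb] at hij
      rw [h.mem_step_pass_pass hb hc] at hjk
      exact (h.mem_step_pass_pass ha hc).2 (hR.trans hij hjk)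

/-! ### Enough edges are kept: maximal classes and non-degeneracy -/

theorem preorderBelow_zero : PreorderBelow 0 [] := ⟨by simp, by simp, by simp⟩

/-- Above every in-frontier edge ending in the center there is a kept one. -/
theorem PreorderBelow.exists_keepIn (hR : PreorderBelow p R) {i : ℕ} (hi : (some i, none) ∈ L)
    (hip : i < p) : ∃ j, KeepIn L R j ∧ (i, j) ∈ R := by
  -- The relation `r a b` says that `a` is strictly above `b`, or equivalent to `b` with a smaller
  -- index. On a finite set it is well-founded, and among the edges into the center its minimal
  -- elements are exactly those satisfying `KeepIn`.
  let r : Fin p → Fin p → Prop := fun a b => (b.1, a.1) ∈ R ∧ ¬ ((a.1, b.1) ∈ R ∧ b ≤ a)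
  have : IsTrans (Fin p) r := ⟨by
    rintro a b c ⟨h1, h2⟩ ⟨h3, h4⟩
    refine ⟨hR.trans h3 h1, ?_⟩
    rintro ⟨h5, h6⟩
    have h7 := hR.trans h1 h5
    have h8 := hR.trans h5 h3
    have : ¬ c ≤ b := fun h => h4 ⟨h7, h⟩
    have : ¬ b ≤ a := fun h => h2 ⟨h8, h⟩
    omega⟩
  have : Std.Irrefl r := ⟨fun a h => h.2 ⟨h.1, le_refl _⟩⟩
  have wf : WellFounded r := Finite.wellFounded_of_trans_of_irrefl r
  suffices ∀ a : Fin p, (some a.1, none) ∈ L → ∃ j, KeepIn L R j ∧ (a.1, j) ∈ R from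
    this ⟨i, hip⟩ hi
  intro a
  induction a using wf.induction with
  | _ a ih =>
    intro ha
    by_cases hk : KeepIn L R a
    · exact ⟨a, hk, hR.refl a.2⟩
    · have : ∃ s ∈ R, s.1 = a ∧ (some s.2, none) ∈ L ∧ ¬ ((s.2, s.1) ∈ R ∧ s.1 ≤ s.2) := by
        by_contra hcon
        push Not at hcon
        exact hk ⟨ha, fun s hs h1 h2 => ⟨(hcon s hs h1 h2).1, (hcon s hs h1 h2).2⟩⟩
      obtain ⟨⟨s1, s2⟩, hs, rfl, h2, h3⟩ := this
      obtain ⟨j, hj, hjR⟩ := ih ⟨s2, (hR.lt hs).2⟩ ⟨hs, h3⟩ h2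
      exact ⟨j, hj, hR.trans hs hjR⟩

/-- Every maximal class of `R` contains a kept edge. -/
def MaxKept (p : ℕ) (R : List (ℕ × ℕ)) (K : List ℕ) : Prop :=
  ∀ i < p, (∀ j, (i, j) ∈ R → (j, i) ∈ R) → ∃ j ∈ K, (i, j) ∈ R

theorem MaxKept.back (h : ValidEdges p q L) (hR : PreorderBelow p R)
    (hK : MaxKept q (step q L R) K') : MaxKept p R (back p L R K') := by
  intro i hi hmax
  -- Either some edge into the center lies above `i`, and a kept one lies above that; or none does,
  -- so the edge at `i` crosses the slice and its class is still maximal at the out-frontier, where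
  -- the hypothesis on `K'` applies.
  by_cases hin : ∃ j, (some j, none) ∈ L ∧ (i, j) ∈ R
  · obtain ⟨j, hj, hij⟩ := hin
    obtain ⟨k, hk, hjk⟩ := hR.exists_keepIn hj (hR.lt hij).2
    exact ⟨k, (h.mem_back_of_in hk.1).2 hk, hR.trans hij hjk⟩
  · obtain ⟨_ | j, hj⟩ := h.exists_in hi
    · exact absurd ⟨i, hj, hR.refl hi⟩ hin
    · obtain ⟨k, hk, hjk⟩ := hK j (h.snd_lt hj) (by
        intro k hjk
        obtain ⟨_ | c, hc⟩ := h.exists_out (lt_of_mem_step hjk).2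
        · exact absurd ((h.mem_step_pass_out hj hc).1 hjk) hin
        · rw [h.mem_step_pass_pass hj hc] at hjk
          exact (h.mem_step_pass_pass hc hj).2 (hmax _ hjk))
      obtain ⟨_ | c, hc⟩ := h.exists_out (lt_of_mem_step hjk).2
      · exact absurd ((h.mem_step_pass_out hj hc).1 hjk) hin
      · exact ⟨c, (h.mem_back_of_pass hc).2 hk, (h.mem_step_pass_pass hj hc).1 hjk⟩

/-- The kept edges join the center to every non-empty frontier. -/
def Good (p q : ℕ) (L : EdgeList) (R : List (ℕ × ℕ)) (K' : List ℕ) : Prop :=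
  (p = 0 ∨ ∃ i ∈ back p L R K', (some i, none) ∈ L) ∧
    (q = 0 ∨ ∃ j ∈ K', (none, some j) ∈ L)

instance : Decidable (Good p q L R K') := by unfold Good; infer_instance

/-- At the in-frontier, `PreorderBelow.exists_keepIn` supplies a kept edge. At the out-frontier, the
edges leaving the center form a maximal class, since the center is the newest vertex, so one of them
is kept. -/
theorem MaxKept.good (h : ValidEdges p q L) (hR : PreorderBelow p R)
    (hK : MaxKept q (step q L R) K') (hin : p ≠ 0 → ∃ i, (some i, none) ∈ L)
    (hout : q ≠ 0 → ∃ j, (none, some j) ∈ L) : Good p q L R K' := by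
  constructor
  · by_cases hp : p = 0
    · exact Or.inl hp
    · obtain ⟨i, hi⟩ := hin hp
      obtain ⟨k, hk, -⟩ := hR.exists_keepIn hi (h.fst_lt hi)
      exact Or.inr ⟨k, (h.mem_back_of_in hk.1).2 hk, hk.1⟩
  · by_cases hq : q = 0
    · exact Or.inl hq
    · obtain ⟨j, hj⟩ := hout hq
      obtain ⟨k, hk, hjk⟩ := hK j (h.snd_lt hj) (by
        intro k hjk
        obtain ⟨_ | c, hc⟩ := h.exists_out (lt_of_mem_step hjk).2
        · exact h.mem_step_out_out hc hj
        · exact absurd hjk (h.not_mem_step_out_pass hj hc))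
      obtain ⟨_ | c, hc⟩ := h.exists_out (lt_of_mem_step hjk).2
      · exact Or.inr ⟨k, hk, hc⟩
      · exact absurd hjk (h.not_mem_step_out_pass hj hc)

end

variable {T : Type u}

/-! ### Edges and paths in a composition with a unit slice -/

namespace Slice

/-- The edge at the `j`-th out-frontier vertex comes from the center vertex `a`. -/
def Src (H : Slice T) (j : ℕ) (a : H.C) : Prop :=
  ∃ e k, H.src e = Sum.inr a ∧ H.tgt e = Sum.inr k ∧ k.val = j

/-- The edge at the `i`-th in-frontier vertex goes to the center vertex `a`. -/
def InTo (H : Slice T) (i : ℕ) (a : H.C) : Prop :=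
  ∃ e k, H.src e = Sum.inl k ∧ H.tgt e = Sum.inl a ∧ k.val = i

/-- An edge joins the `i`-th in-frontier vertex to the `j`-th out-frontier vertex. -/
def Pass (H : Slice T) (i j : ℕ) : Prop :=
  ∃ e k l, H.src e = Sum.inl k ∧ H.tgt e = Sum.inr l ∧ k.val = i ∧ l.val = j

theorem Src.lt {H : Slice T} {j : ℕ} {a : H.C} (h : H.Src j a) : j < H.outs := by
  obtain ⟨e, k, -, -, rfl⟩ := h
  exact k.2

theorem Src.unique {H : Slice T} {j : ℕ} {a b : H.C} (h : H.Src j a) (h' : H.Src j b) : a = b := by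
  obtain ⟨e, k, h1, h2, rfl⟩ := h
  obtain ⟨e', k', h1', h2', hk⟩ := h'
  obtain rfl := Fin.ext hk
  obtain rfl := (H.out_unique k').unique h2 h2'
  exact Sum.inr_injective (h1.symm.trans h1')

theorem exists_src {H : Slice T} (h0 : H.ins = 0) {j : ℕ} (hj : j < H.outs) : ∃ a, H.Src j a := by
  obtain ⟨e, he, -⟩ := H.out_unique ⟨j, hj⟩
  cases hs : H.src e with
  | inl k => exact absurd k.2 (by omega)
  | inr a => exact ⟨a, e, _, hs, he, rfl⟩

section comp

variable {H S : Slice T} {h : H.Composable S}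

theorem comp_adj_inl_inl {a b : H.C} :
    (H.comp S h).Adj (Sum.inl a) (Sum.inl b) ↔ H.Adj a b := by
  constructor
  · rintro ⟨⟨e, he⟩ | ⟨e, he⟩ | ⟨⟨e, f⟩, he⟩, h1, h2⟩
    · obtain ⟨c, hc⟩ := Sum.isLeft_iff.1 he
      cases hs : H.src e with
      | inl k => simp [comp, compSrc, hs] at h1
      | inr d =>
        simp only [comp, compSrc, hs, compTgt, hc, Sum.map_inr, Sum.inr.injEq, Sum.inl.injEq,
          Sum.getLeft_inl] at h1 h2
        subst h1 h2
        exact ⟨e, hs, hc⟩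
    · simp [comp, compSrc] at h1
    · cases hs : S.tgt f <;> simp [comp, compTgt, hs] at h2
  · rintro ⟨e, h1, h2⟩
    exact ⟨Sum.inl ⟨e, by simp [h2]⟩, by simp [comp, compSrc, h1], by simp [comp, compTgt, h2]⟩

theorem comp_adj_inl_inr {a : H.C} {c : S.C} :
    (H.comp S h).Adj (Sum.inl a) (Sum.inr c) ↔ ∃ j, H.Src j a ∧ S.InTo j c := by
  constructor
  · rintro ⟨⟨e, he⟩ | ⟨e, he⟩ | ⟨⟨e, f⟩, j, h3, h4⟩, h1, h2⟩
    · simp [comp, compTgt] at h2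
    · simp [comp, compSrc] at h1
    · cases hs : H.src e with
      | inl k => simp [comp, compSrc, hs] at h1
      | inr d =>
        cases ht : S.tgt f with
        | inr k => simp [comp, compTgt, ht] at h2
        | inl d' =>
          simp only [comp, compSrc, hs, compTgt, ht, Sum.map_inr, Sum.map_inl, Sum.inr.injEq,
            Sum.inl.injEq] at h1 h2
          subst h1 h2
          exact ⟨j, ⟨e, j, hs, h3, rfl⟩, f, _, h4, ht, rfl⟩
  · rintro ⟨_, ⟨e, j, h1, h2, rfl⟩, f, k, h3, h4, h5⟩
    refine ⟨Sum.inr (Sum.inr ⟨(e, f), j, h2, ?_⟩), by simp [comp, compSrc, h1],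
      by simp [comp, compTgt, h4]⟩
    rw [h3]
    exact congrArg _ (Fin.ext h5)

theorem comp_not_adj_inr_inl {a : H.C} {c : S.C} :
    ¬ (H.comp S h).Adj (Sum.inr c) (Sum.inl a) := by
  rintro ⟨⟨e, he⟩ | ⟨e, he⟩ | ⟨⟨e, f⟩, j, h3, h4⟩, h1, h2⟩
  · cases hs : H.src e <;> simp [comp, compSrc, hs] at h1
  · cases hs : S.tgt e <;> simp [comp, compTgt, hs] at h2
  · cases hs : H.src e <;> simp [comp, compSrc, hs] at h1

theorem comp_adj_inr_inr {c d : S.C} :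
    (H.comp S h).Adj (Sum.inr c) (Sum.inr d) ↔ S.Adj c d := by
  constructor
  · rintro ⟨⟨e, he⟩ | ⟨e, he⟩ | ⟨⟨e, f⟩, he⟩, h1, h2⟩
    · cases hs : H.src e <;> simp [comp, compSrc, hs] at h1
    · obtain ⟨c', hc⟩ := Sum.isRight_iff.1 he
      cases hs : S.tgt e with
      | inr k => simp [comp, compTgt, hs] at h2
      | inl d =>
        simp only [comp, compSrc, hs, compTgt, hc, Sum.map_inl, Sum.inr.injEq, Sum.inl.injEq,
          Sum.getRight_inr] at h1 h2
        subst h1 h2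
        exact ⟨e, hc, hs⟩
    · cases hs : H.src e <;> simp [comp, compSrc, hs] at h1
  · rintro ⟨e, h1, h2⟩
    exact ⟨Sum.inr (Sum.inl ⟨e, by simp [h1]⟩), by simp [comp, compSrc, h1],
      by simp [comp, compTgt, h2]⟩

theorem comp_src_inl {j : ℕ} {a : H.C} :
    (H.comp S h).Src j (Sum.inl a) ↔ ∃ i, H.Src i a ∧ S.Pass i j := by
  constructor
  · rintro ⟨⟨e, he⟩ | ⟨e, he⟩ | ⟨⟨e, f⟩, i, h3, h4⟩, k, h1, h2, rfl⟩
    · simp [comp, compTgt] at h2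
    · simp [comp, compSrc] at h1
    · cases hs : H.src e with
      | inl k => simp [comp, compSrc, hs] at h1
      | inr d =>
        cases ht : S.tgt f with
        | inl k => simp [comp, compTgt, ht] at h2
        | inr d' =>
          simp only [comp, compSrc, hs, compTgt, ht, Sum.map_inr, Sum.inr.injEq,
            Sum.inl.injEq, id_eq] at h1 h2
          subst h1
          exact ⟨i, ⟨e, i, hs, h3, rfl⟩, f, _, _, h4, ht.trans (congrArg _ (Sum.inr.inj h2)), rfl, rfl⟩
  · rintro ⟨_, ⟨e, i, h1, h2, rfl⟩, f, k, l, h3, h4, h5, rfl⟩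
    refine ⟨Sum.inr (Sum.inr ⟨(e, f), i, h2, ?_⟩), l, by simp [comp, compSrc, h1],
      by simp [comp, compTgt, h4], rfl⟩
    rw [h3]
    exact congrArg _ (Fin.ext h5)

theorem comp_src_inr {j : ℕ} {c : S.C} :
    (H.comp S h).Src j (Sum.inr c) ↔ S.Src j c := by
  constructor
  · rintro ⟨⟨e, he⟩ | ⟨e, he⟩ | ⟨⟨e, f⟩, i, h3, h4⟩, k, h1, h2, rfl⟩
    · simp [comp, compTgt] at h2
    · obtain ⟨c', hc⟩ := Sum.isRight_iff.1 he
      cases hs : S.tgt e with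
      | inl k => simp [comp, compTgt, hs] at h2
      | inr d =>
        simp only [comp, compSrc, hs, compTgt, hc, Sum.map_inr, Sum.inr.injEq,
          Sum.getRight_inr, id_eq] at h1 h2
        subst h1
        exact ⟨e, _, hc, hs.trans (congrArg _ (Sum.inr.inj h2)), rfl⟩
    · cases hs : H.src e <;> simp [comp, compSrc, hs] at h1
  · rintro ⟨e, k, h1, h2, rfl⟩
    exact ⟨Sum.inr (Sum.inl ⟨e, by simp [h1]⟩), k, by simp [comp, compSrc, h1],
      by simp [comp, compTgt, h2], rfl⟩

end comp

theorem IsUnitSlice.eq {S : Slice T} (hS : S.IsUnitSlice) (c d : S.C) : c = d := by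
  obtain ⟨x, hx⟩ := hS
  rw [hx c, hx d]

theorem IsUnitSlice.not_adj {S : Slice T} (hS : S.IsUnitSlice) (c d : S.C) : ¬ S.Adj c d := by
  intro h
  obtain rfl := hS.eq c d
  exact S.acyclic c (Relation.TransGen.single h)

section compUnit

variable {H S : Slice T} {h : H.Composable S}

theorem comp_unit_not_transGen_inr (hS : S.IsUnitSlice) {c : S.C} {x : H.C ⊕ S.C} :
    ¬ Relation.TransGen (H.comp S h).Adj (Sum.inr c) x := by
  intro hx
  obtain ⟨y, hy, -⟩ := Relation.TransGen.head'_iff.1 hx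
  cases y with
  | inl a => exact comp_not_adj_inr_inl hy
  | inr d => exact hS.not_adj _ _ (comp_adj_inr_inr.1 hy)

/-- A path that has entered the second slice never returns, so a path between old vertices stays
among old vertices. -/
theorem comp_transGen_inl_inl {a b : H.C} :
    Relation.TransGen (H.comp S h).Adj (Sum.inl a) (Sum.inl b) ↔ Relation.TransGen H.Adj a b := by
  constructor
  · intro hab
    have key : ∀ y, Relation.TransGen (H.comp S h).Adj (Sum.inl a) y →
        ∀ b, y = Sum.inl b → Relation.TransGen H.Adj a b := by
      intro y hy
      induction hy with
      | single h1 =>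
        rintro b rfl
        exact Relation.TransGen.single (comp_adj_inl_inl.1 h1)
      | @tail z _ _ h1 ih =>
        rintro b rfl
        cases z with
        | inl z => exact (ih z rfl).tail (comp_adj_inl_inl.1 h1)
        | inr c => exact absurd h1 comp_not_adj_inr_inl
    exact key _ hab b rfl
  · exact fun hab => hab.lift (p := (H.comp S h).Adj) Sum.inl (fun _ _ h1 => comp_adj_inl_inl.2 h1)

/-- The last step of a path to the new vertex is a glued edge, because a unit slice has no edge from
its center to itself. -/
theorem comp_transGen_inl_inr (hS : S.IsUnitSlice) {a : H.C} {c : S.C} :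
    Relation.TransGen (H.comp S h).Adj (Sum.inl a) (Sum.inr c) ↔
      ∃ j b, H.Src j b ∧ S.InTo j c ∧ Relation.ReflTransGen H.Adj a b := by
  constructor
  · intro hac
    obtain ⟨z, h1, h2⟩ := Relation.TransGen.tail'_iff.1 hac
    cases z with
    | inr d => exact absurd (comp_adj_inr_inr.1 h2) (hS.not_adj _ _)
    | inl b =>
      obtain ⟨j, hj, hj'⟩ := comp_adj_inl_inr.1 h2
      refine ⟨j, b, hj, hj', ?_⟩
      rcases Relation.reflTransGen_iff_eq_or_transGen.1 h1 with h1 | h1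
      · rw [Sum.inl.inj h1]
      · exact (comp_transGen_inl_inl.1 h1).to_reflTransGen
  · rintro ⟨j, b, hj, hj', hab⟩
    refine Relation.TransGen.tail'_iff.2 ⟨Sum.inl b, ?_, comp_adj_inl_inr.2 ⟨j, hj, hj'⟩⟩
    exact hab.lift (p := (H.comp S h).Adj) Sum.inl (fun _ _ h1 => comp_adj_inl_inl.2 h1)

theorem comp_reflTransGen_inl_inl {a b : H.C} :
    Relation.ReflTransGen (H.comp S h).Adj (Sum.inl a) (Sum.inl b) ↔
      Relation.ReflTransGen H.Adj a b := by
  refine Relation.reflTransGen_iff_eq_or_transGen.trans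
    (Iff.trans ?_ Relation.reflTransGen_iff_eq_or_transGen.symm)
  exact or_congr Sum.inl_injective.eq_iff comp_transGen_inl_inl

end compUnit

theorem IsCompositionOf.ne_nil {w : List (Slice T)} {H : Slice T} (h : IsCompositionOf w H) :
    w ≠ [] := by
  cases h <;> simp

/-- Compositions are bracketed to the left, so the string determines the slice itself and not just
its isomorphism class. This identifies an arbitrary element of the graph language with the
composition built along the walk. -/
theorem IsCompositionOf.unique {w : List (Slice T)} {H H' : Slice T} (h : IsCompositionOf w H)
    (h' : IsCompositionOf w H') : H = H' := by
  suffices ∀ w', IsCompositionOf w' H' → w = w' → H = H' from this w h' rfl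
  induction h generalizing H' with
  | single S =>
    intro w' h' hw
    cases h' with
    | single S' => simpa using hw
    | snoc hw' hc =>
      exact absurd hw (fun hw => hw'.ne_nil (List.append_eq_singleton_iff.1 hw.symm |>.elim
        (fun h => h.1) (fun h => by simp at h)))
  | @snoc w0 H0 S0 h0 hc ih =>
    intro w' h' hw
    cases h' with
    | single S' =>
      exact absurd hw (fun hw => h0.ne_nil (List.append_eq_singleton_iff.1 hw |>.elim
        (fun h => h.1) (fun h => by simp at h)))
    | @snoc w1 H1 S1 h1 hc' =>
      obtain ⟨rfl, hS⟩ := List.append_inj' hw rfl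
      obtain rfl : S0 = S1 := by simpa using hS
      obtain rfl := ih h1 _ h1 rfl
      rfl

end Slice

/-! ### Codes versus unit slices -/

/-- The unit slice described by a code. -/
def unitSlice (t : T) (p q : ℕ) (L : EdgeList) (h : ValidEdges p q L) : Slice T where
  C := Unit
  E := {x // x ∈ L}
  finite_C := inferInstance
  finite_E := inferInstance
  nonempty_C := inferInstance
  ins := p
  outs := q
  label := fun _ => t
  src := fun x => match x with
    | ⟨(some i, _), hx⟩ => Sum.inl ⟨i, h.fst_lt hx⟩
    | ⟨(none, _), _⟩ => Sum.inr ()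
  tgt := fun x => match x with
    | ⟨(_, some j), hx⟩ => Sum.inr ⟨j, h.snd_lt hx⟩
    | ⟨(_, none), _⟩ => Sum.inl ()
  in_unique := by
    rintro ⟨i, hi⟩
    obtain ⟨b, hb⟩ := h.exists_in hi
    refine ⟨⟨(some i, b), hb⟩, rfl, ?_⟩
    rintro ⟨⟨_ | a, c⟩, ha⟩ he
    · simp at he
    · simp only [Sum.inl.injEq, Fin.mk.injEq] at he
      subst he
      obtain rfl := h.in_unique hb ha
      rfl
  out_unique := by
    rintro ⟨j, hj⟩
    obtain ⟨b, hb⟩ := h.exists_out hj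
    refine ⟨⟨(b, some j), hb⟩, rfl, ?_⟩
    rintro ⟨⟨c, _ | a⟩, ha⟩ he
    · simp at he
    · simp only [Sum.inr.injEq, Fin.mk.injEq] at he
      subst he
      obtain rfl := h.out_unique hb ha
      rfl
  acyclic := by
    intro u hu
    obtain ⟨y, ⟨⟨⟨_ | i, _ | j⟩, hx⟩, h1, h2⟩, -⟩ := Relation.TransGen.head'_iff.1 hu
    · exact h.center hx
    · simp at h2
    · simp at h1
    · simp at h1

theorem describes_unitSlice (t : T) (p q : ℕ) (L : EdgeList) (h : ValidEdges p q L) :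
    UnitSliceCode.Describes (t, p, q, L) (unitSlice t p q L h) := by
  have key : ∀ x : {x // x ∈ L}, x.1 =
      (Sum.elim (fun i => some i.val) (fun _ => none) ((unitSlice t p q L h).src x),
       Sum.elim (fun _ => none) (fun j => some j.val) ((unitSlice t p q L h).tgt x)) := by
    rintro ⟨⟨_ | i, _ | j⟩, hx⟩ <;> rfl
  exact ⟨⟨(), fun _ => rfl⟩, fun _ => rfl, rfl, rfl, h.nodup.getEquiv L, 
    fun k => key (h.nodup.getEquiv L k)⟩

namespace UnitSliceCode.Describes

variable {t : T} {p q : ℕ} {L : EdgeList} {S : Slice T}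

theorem mem_iff (h : Describes (t, p, q, L) S) {x : Option ℕ × Option ℕ} :
    x ∈ L ↔ ∃ e, x = (Sum.elim (fun i => some i.val) (fun _ => none) (S.src e),
       Sum.elim (fun _ => none) (fun j => some j.val) (S.tgt e)) := by
  obtain ⟨-, -, -, -, b, hb⟩ := h
  rw [List.mem_iff_get]
  constructor
  · rintro ⟨k, rfl⟩
    exact ⟨b k, hb k⟩
  · rintro ⟨e, rfl⟩
    exact ⟨b.symm e, by simpa using hb (b.symm e)⟩

theorem mem_in_iff (h : Describes (t, p, q, L) S) {i : ℕ} (c : S.C) :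
    (some i, none) ∈ L ↔ S.InTo i c := by
  rw [h.mem_iff]
  constructor
  · rintro ⟨e, he⟩
    cases hs : S.src e <;> cases ht : S.tgt e <;> simp [hs, ht] at he
    exact ⟨e, _, hs, by rw [ht, h.1.eq c], he.symm⟩
  · rintro ⟨e, k, h1, h2, rfl⟩
    exact ⟨e, by simp [h1, h2]⟩

theorem mem_out_iff (h : Describes (t, p, q, L) S) {j : ℕ} (c : S.C) :
    (none, some j) ∈ L ↔ S.Src j c := by
  rw [h.mem_iff]
  constructor
  · rintro ⟨e, he⟩
    cases hs : S.src e <;> cases ht : S.tgt e <;> simp [hs, ht] at he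
    exact ⟨e, _, by rw [hs, h.1.eq c], ht, he.symm⟩
  · rintro ⟨e, k, h1, h2, rfl⟩
    exact ⟨e, by simp [h1, h2]⟩

theorem mem_pass_iff (h : Describes (t, p, q, L) S) {i j : ℕ} :
    (some i, some j) ∈ L ↔ S.Pass i j := by
  rw [h.mem_iff]
  constructor
  · rintro ⟨e, he⟩
    cases hs : S.src e <;> cases ht : S.tgt e <;> simp [hs, ht] at he
    exact ⟨e, _, _, hs, ht, he.1.symm, he.2.symm⟩
  · rintro ⟨e, k, l, h1, h2, rfl, rfl⟩
    exact ⟨e, by simp [h1, h2]⟩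

/-- An edge from the center to itself would be a cycle, so each edge touches a frontier vertex and
is determined by it. Distinct edges therefore have distinct entries, and the list has no
repetitions. -/
theorem validEdges (h : Describes (t, p, q, L) S) : ValidEdges p q L := by
  have hm := @h.mem_iff
  have hu := h.1
  obtain ⟨c, -⟩ := id hu
  obtain ⟨-, -, hp, hq, b, hb⟩ := h
  simp only at hp hq hb
  have srcEq : ∀ {e i}, Sum.elim (fun i : Fin S.ins => some i.val) (fun _ => none) (S.src e) = some i →
      ∃ hi : i < p, S.src e = Sum.inl ⟨i, hp ▸ hi⟩ := by
    intro e i he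
    cases hs : S.src e with
    | inr c => simp [hs] at he
    | inl k =>
      simp only [hs, Sum.elim_inl, Option.some.injEq] at he
      subst he
      exact ⟨hp ▸ k.2, rfl⟩
  have tgtEq : ∀ {e i}, Sum.elim (fun _ => none) (fun j : Fin S.outs => some j.val) (S.tgt e) = some i →
      ∃ hi : i < q, S.tgt e = Sum.inr ⟨i, hq ▸ hi⟩ := by
    intro e i he
    cases hs : S.tgt e with
    | inl c => simp [hs] at he
    | inr k =>
      simp only [hs, Sum.elim_inr, Option.some.injEq] at he
      subst he
      exact ⟨hq ▸ k.2, rfl⟩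
  have hcenter : (none, none) ∉ L := by
    rw [hm]
    rintro ⟨e, he⟩
    cases hs : S.src e <;> cases ht : S.tgt e <;> simp [hs, ht] at he
    exact hu.not_adj _ _ ⟨e, hs, ht⟩
  refine ⟨?_, hcenter, ?_, ?_, ?_, ?_, ?_, ?_⟩
  · rw [List.nodup_iff_injective_get]
    intro k l hkl
    apply b.injective
    cases hs : S.src (b k) with
    | inl i =>
      have h1 := hb l
      rw [← hkl, hb k, hs] at h1
      obtain ⟨hi, h2⟩ := srcEq (Prod.mk.inj h1).1.symm
      exact (S.in_unique i).unique hs h2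
    | inr c =>
      cases ht : S.tgt (b k) with
      | inl c => exact absurd ⟨_, hs, ht⟩ (hu.not_adj _ _)
      | inr j =>
        have h1 := hb l
        rw [← hkl, hb k, ht] at h1
        obtain ⟨hj, h2⟩ := tgtEq (Prod.mk.inj h1).2.symm
        exact (S.out_unique j).unique ht h2
  · intro i b hx
    obtain ⟨e, he⟩ := hm.1 hx
    exact (srcEq (Prod.mk.inj he).1.symm).1
  · intro i b hx
    obtain ⟨e, he⟩ := hm.1 hx
    exact (tgtEq (Prod.mk.inj he).2.symm).1
  · intro i hi
    obtain ⟨e, he, -⟩ := S.in_unique ⟨i, hp ▸ hi⟩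
    exact ⟨_, hm.2 ⟨e, by rw [he]; rfl⟩⟩
  · intro i hi
    obtain ⟨e, he, -⟩ := S.out_unique ⟨i, hq ▸ hi⟩
    exact ⟨_, hm.2 ⟨e, by rw [he]; rfl⟩⟩
  · intro i b b' hx hy
    obtain ⟨e, he⟩ := hm.1 hx
    obtain ⟨e', he'⟩ := hm.1 hy
    obtain ⟨_, h1⟩ := srcEq (Prod.mk.inj he).1.symm
    obtain ⟨_, h2⟩ := srcEq (Prod.mk.inj he').1.symm
    obtain rfl := (S.in_unique _).unique h1 h2
    rw [(Prod.mk.inj he).2, (Prod.mk.inj he').2]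
  · intro i b b' hx hy
    obtain ⟨e, he⟩ := hm.1 hx
    obtain ⟨e', he'⟩ := hm.1 hy
    obtain ⟨_, h1⟩ := tgtEq (Prod.mk.inj he).2.symm
    obtain ⟨_, h2⟩ := tgtEq (Prod.mk.inj he').2.symm
    obtain rfl := (S.out_unique _).unique h1 h2
    rw [(Prod.mk.inj he).1, (Prod.mk.inj he').1]

end UnitSliceCode.Describes

/-! ### The reduction invariant along a walk -/

namespace Slice

/-- Simplicity concerns edges and not just adjacency, so the edge itself has to be traced back to
its origin; `comp_edge_inl_inr` does this for the glued edges. -/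
theorem comp_edge_inl_inl {H S : Slice T} {h : H.Composable S} {e : (H.comp S h).E} {a b : H.C}
    (h1 : (H.comp S h).src e = Sum.inr (Sum.inl a))
    (h2 : (H.comp S h).tgt e = Sum.inl (Sum.inl b)) :
    ∃ e₀ h₀, e = Sum.inl ⟨e₀, h₀⟩ ∧ H.src e₀ = Sum.inr a ∧ H.tgt e₀ = Sum.inl b := by
  obtain ⟨e, he⟩ | ⟨e, he⟩ | ⟨⟨e, f⟩, he⟩ := e
  · refine ⟨e, he, rfl, ?_⟩
    obtain ⟨c, hc⟩ := Sum.isLeft_iff.1 he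
    cases hs : H.src e with
    | inl k => simp [comp, compSrc, hs] at h1
    | inr d =>
      simp only [comp, compSrc, hs, compTgt, hc, Sum.map_inr, Sum.inr.injEq, Sum.inl.injEq,
        Sum.getLeft_inl] at h1 h2
      exact ⟨by rw [h1], by rw [hc, h2]⟩
  · simp [comp, compSrc] at h1
  · cases hs : S.tgt f <;> simp [comp, compTgt, hs] at h2

theorem comp_edge_inl_inr {H S : Slice T} {h : H.Composable S} {e : (H.comp S h).E} {a : H.C}
    {c : S.C} (h1 : (H.comp S h).src e = Sum.inr (Sum.inl a))
    (h2 : (H.comp S h).tgt e = Sum.inl (Sum.inr c)) :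
    ∃ e₀ f₀ h₀ j, e = Sum.inr (Sum.inr ⟨(e₀, f₀), h₀⟩) ∧ H.src e₀ = Sum.inr a ∧
      H.tgt e₀ = Sum.inr j ∧ S.src f₀ = Sum.inl (Fin.cast h j) ∧ S.tgt f₀ = Sum.inl c := by
  obtain ⟨e, he⟩ | ⟨e, he⟩ | ⟨⟨e, f⟩, he⟩ := e
  · simp [comp, compTgt] at h2
  · simp [comp, compSrc] at h1
  · refine ⟨e, f, he, ?_⟩
    obtain ⟨j, h3, h4⟩ := he
    refine ⟨j, rfl, ?_, h3, h4, ?_⟩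
    · cases hs : H.src e with
      | inl k => simp [comp, compSrc, hs] at h1
      | inr d =>
        simp only [comp, compSrc, hs, Sum.map_inr, Sum.inr.injEq, Sum.inl.injEq] at h1
        rw [h1]
    · cases hs : S.tgt f with
      | inr k => simp [comp, compTgt, hs] at h2
      | inl d =>
        simp only [comp, compTgt, hs, Sum.map_inl, Sum.inr.injEq, Sum.inl.injEq] at h2
        rw [h2]

/-- The slice `H'` is the transitive reduction of the initial slice `H`, with the edges at the
out-frontier restricted to those in `K`; `R` is the preorder of the sources at the out-frontier. -/
structure Reduces (H H' : Slice T) (φ : H'.C ≃ H.C) (R : List (ℕ × ℕ)) (K : List ℕ) : Prop where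
  ins : H.ins = 0
  outs' : H'.outs = K.length
  label : ∀ a, H.label (φ a) = H'.label a
  lt_iff : ∀ a b, Relation.TransGen H'.Adj a b ↔ Relation.TransGen H.Adj (φ a) (φ b)
  src_iff : ∀ j a, H'.Src j a ↔ ∃ i, K[j]? = some i ∧ H.Src i (φ a)
  preorder : PreorderBelow H.outs R
  rel : ∀ {i j a b}, H.Src i a → H.Src j b → ((i, j) ∈ R ↔ Relation.ReflTransGen H.Adj a b)
  simple : ∀ {e e' a b}, H'.src e = Sum.inr a → H'.src e' = Sum.inr a → H'.tgt e = Sum.inl b →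
    H'.tgt e' = Sum.inl b → e = e'
  hasse : ∀ {a b}, H'.Adj a b → ∀ x, Relation.TransGen H'.Adj a x →
    ¬ Relation.TransGen H'.Adj x b

theorem Reduces.le_iff {H H' : Slice T} {φ : H'.C ≃ H.C} {R : List (ℕ × ℕ)} {K : List ℕ}
    (h : Reduces H H' φ R K) (a b : H'.C) :
    Relation.ReflTransGen H'.Adj a b ↔ Relation.ReflTransGen H.Adj (φ a) (φ b) := by
  rw [Relation.reflTransGen_iff_eq_or_transGen, Relation.reflTransGen_iff_eq_or_transGen,
    h.lt_iff, φ.injective.eq_iff]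

/-- The bijection between the centers of two unit slices. -/
noncomputable def unitEquiv {S S' : Slice T} (hS : S.IsUnitSlice) (hS' : S'.IsUnitSlice) : S'.C ≃ S.C where
  toFun _ := hS.choose
  invFun _ := hS'.choose
  left_inv _ := hS'.eq _ _
  right_inv _ := hS.eq _ _

section

variable {S S' : Slice T} {t : T} {p q : ℕ} {L : EdgeList} {R : List (ℕ × ℕ)} {K' : List ℕ}

theorem reduces_unit (hS : UnitSliceCode.Describes (t, p, q, L) S)
    (hS' : UnitSliceCode.Describes (t, (back p L [] K').length, K'.length,
      restrict L (back p L [] K') K') S')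
    (hK' : K'.Sublist (List.range q)) (hp : p = 0) :
    Reduces S S' (unitEquiv hS.1 hS'.1) (step q L []) K' := by
  subst hp
  have v := hS.validEdges
  have hout : S.outs = q := hS.2.2.2.1
  have n2 : K'.Nodup := List.nodup_range.sublist hK'
  have noT : ∀ {S : Slice T}, S.IsUnitSlice → ∀ a b, ¬ Relation.TransGen S.Adj a b := by
    intro S hS a b hab
    obtain ⟨y, hy, -⟩ := Relation.TransGen.head'_iff.1 hab
    exact hS.not_adj _ _ hy
  refine ⟨hS.2.2.1, hS'.2.2.2.1, fun a => ?_, ?_, ?_, ?_, ?_, ?_, ?_⟩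
  · rw [hS.2.1, hS'.2.1]
  · exact fun a b => iff_of_false (noT hS'.1 _ _) (noT hS.1 _ _)
  · intro j a
    rw [← hS'.mem_out_iff, mem_restrict_out n2]
    simp only [hS.mem_out_iff (unitEquiv hS.1 hS'.1 a)]
  · rw [hout]
    exact preorderBelow_zero.step v
  · intro i j a b hi hj
    obtain rfl := hS.1.eq a b
    rw [← hS.mem_out_iff] at hi hj
    exact iff_of_true (v.mem_step_out_out hi hj) Relation.ReflTransGen.refl
  · intro e e' a b h1 _ h2 _
    exact absurd ⟨e, h1, h2⟩ (hS'.1.not_adj a b)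
  · exact fun h => absurd h (hS'.1.not_adj _ _)

/-- Relations and edges among old vertices are inherited. For the new vertex, deleting edges
preserves reachability because every edge into it has a kept edge above it; the remaining edges are
covers because kept sources are maximal, and simple because ties are broken by the least index. -/
theorem Reduces.comp {H H' : Slice T} {φ : H'.C ≃ H.C} (hH : Reduces H H' φ R (back p L R K'))
    (hS : UnitSliceCode.Describes (t, p, q, L) S)
    (hS' : UnitSliceCode.Describes (t, (back p L R K').length, K'.length,
      restrict L (back p L R K') K') S')
    (hK' : K'.Sublist (List.range q)) (h : H.Composable S) (h' : H'.Composable S') :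
    Reduces (H.comp S h) (H'.comp S' h') (Equiv.sumCongr φ (unitEquiv hS.1 hS'.1))
      (step q L R) K' := by
  have v := hS.validEdges
  have hout : S.outs = q := hS.2.2.2.1
  have hpo : H.outs = p := h.trans hS.2.2.1
  have n2 : K'.Nodup := List.nodup_range.sublist hK'
  have n1 : (back p L R K').Nodup := back_nodup
  have hR : PreorderBelow p R := hpo ▸ hH.preorder
  -- A glued edge of the reduced composition comes from an original frontier index that passes the
  -- test `KeepIn`.
  have key : ∀ {j a c}, H'.Src j a → S'.InTo j c → ∃ i, (back p L R K')[j]? = some i ∧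
      H.Src i (φ a) ∧ KeepIn L R i := by
    intro j a c h1 h2
    rw [← hS'.mem_in_iff, mem_restrict_in n1] at h2
    obtain ⟨i, hi, hs⟩ := (hH.src_iff _ _).1 h1
    obtain ⟨i', hi', hin⟩ := h2
    obtain rfl : i = i' := by simpa [hi] using hi'
    exact ⟨i, hi, hs, (v.mem_back_of_in hin).1 (List.mem_of_getElem? hi)⟩
  have lt_new : ∀ a c, Relation.TransGen (H'.comp S' h').Adj (Sum.inl a) (Sum.inr c) ↔
      Relation.TransGen (H.comp S h).Adj (Sum.inl (φ a)) (Sum.inr (unitEquiv hS.1 hS'.1 c)) := by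
    intro a c
    refine (comp_transGen_inl_inr hS'.1).trans
      (Iff.trans ?_ (comp_transGen_inl_inr hS.1).symm)
    constructor
    · rintro ⟨j, b, h1, h2, h3⟩
      obtain ⟨i, -, hi, hk⟩ := key h1 h2
      exact ⟨i, φ b, hi, (hS.mem_in_iff _).1 hk.1, (hH.le_iff _ _).1 h3⟩
    -- The last edge of the original path may have been deleted. It is replaced by a kept edge whose
    -- source `x` lies above its source, and `x` can be reached by the invariant.
    · rintro ⟨j, b, h1, h2, h3⟩
      rw [← hS.mem_in_iff] at h2
      obtain ⟨i, hk, hji⟩ := hR.exists_keepIn h2 (v.fst_lt h2)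
      obtain ⟨x, hx⟩ := exists_src hH.ins (hpo ▸ (hR.lt hji).2)
      have hm : i ∈ back p L R K' := (v.mem_back_of_in hk.1).2 hk
      have hg := (getElem?_eq_some_iff_idxOf n1).2 ⟨hm, rfl⟩
      refine ⟨_, φ.symm x, (hH.src_iff _ _).2 ⟨i, hg, by simpa using hx⟩,
        (hS'.mem_in_iff c).1 ((mem_restrict_in n1).2 ⟨i, hg, hk.1⟩), ?_⟩
      rw [hH.le_iff, Equiv.apply_symm_apply]
      exact h3.trans ((hH.rel h1 hx).1 hji)
  refine ⟨hH.ins, hS'.2.2.2.1, ?_, ?_, ?_, ?_, ?_, ?_, ?_⟩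
  · rintro (a | c)
    · exact hH.label a
    · exact (hS.2.1 _).trans (hS'.2.1 c).symm
  · rintro (a | c) (b | d)
    · exact comp_transGen_inl_inl.trans ((hH.lt_iff a b).trans comp_transGen_inl_inl.symm)
    · exact lt_new a d
    · exact iff_of_false (comp_unit_not_transGen_inr hS'.1) (comp_unit_not_transGen_inr hS.1)
    · exact iff_of_false (comp_unit_not_transGen_inr hS'.1) (comp_unit_not_transGen_inr hS.1)
  · rintro j (a | c)
    · refine comp_src_inl.trans (Iff.trans ?_ (exists_congr fun i =>
        and_congr_right fun _ => comp_src_inl.symm))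
      constructor
      · rintro ⟨k, h1, h2⟩
        rw [← hS'.mem_pass_iff, mem_restrict_pass n1 n2] at h2
        obtain ⟨i, hi, hs⟩ := (hH.src_iff _ _).1 h1
        obtain ⟨i', l, hi', hl, hp⟩ := h2
        obtain rfl : i = i' := by simpa [hi] using hi'
        exact ⟨l, hl, i, hs, hS.mem_pass_iff.1 hp⟩
      · rintro ⟨l, hl, i, hs, hp⟩
        rw [← hS.mem_pass_iff] at hp
        have hm : i ∈ back p L R K' := (v.mem_back_of_pass hp).2 (List.mem_of_getElem? hl)
        have hg := (getElem?_eq_some_iff_idxOf n1).2 ⟨hm, rfl⟩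
        exact ⟨_, (hH.src_iff _ _).2 ⟨i, hg, hs⟩,
          hS'.mem_pass_iff.1 ((mem_restrict_pass n1 n2).2 ⟨i, l, hg, hl, hp⟩)⟩
    · refine comp_src_inr.trans (Iff.trans ?_ (exists_congr fun i =>
        and_congr_right fun _ => comp_src_inr.symm))
      rw [← hS'.mem_out_iff, mem_restrict_out n2]
      simp only [hS.mem_out_iff (unitEquiv hS.1 hS'.1 c)]
  · change PreorderBelow S.outs _
    rw [hout]
    exact hR.step v
  · rintro i j (a | c) (b | d) h1 h2
    · obtain ⟨i', h1, h3⟩ := comp_src_inl.1 h1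
      obtain ⟨j', h2, h4⟩ := comp_src_inl.1 h2
      rw [← hS.mem_pass_iff] at h3 h4
      exact (v.mem_step_pass_pass h3 h4).trans
        ((hH.rel h1 h2).trans comp_reflTransGen_inl_inl.symm)
    · obtain ⟨i', h1, h3⟩ := comp_src_inl.1 h1
      have h4 := comp_src_inr.1 h2
      rw [← hS.mem_pass_iff] at h3
      rw [← hS.mem_out_iff] at h4
      refine (v.mem_step_pass_out h3 h4).trans (Iff.trans ?_
        (Relation.reflTransGen_iff_eq_or_transGen.trans (or_iff_right (by simp))).symm)
      refine Iff.trans ?_ (comp_transGen_inl_inr hS.1).symm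
      constructor
      · rintro ⟨k, hk, hik⟩
        obtain ⟨x, hx⟩ := exists_src hH.ins (hpo ▸ (hR.lt hik).2)
        exact ⟨k, x, hx, (hS.mem_in_iff _).1 hk, (hH.rel h1 hx).1 hik⟩
      · rintro ⟨k, x, hx, hk, hax⟩
        exact ⟨k, (hS.mem_in_iff _).2 hk, (hH.rel h1 hx).2 hax⟩
    · obtain ⟨j', h2, h4⟩ := comp_src_inl.1 h2
      have h3 := comp_src_inr.1 h1
      rw [← hS.mem_pass_iff] at h4
      rw [← hS.mem_out_iff] at h3
      refine iff_of_false (v.not_mem_step_out_pass h3 h4) fun hr => ?_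
      rcases Relation.reflTransGen_iff_eq_or_transGen.1 hr with hr | hr
      · simp at hr
      · exact comp_unit_not_transGen_inr hS.1 hr
    · have h3 := comp_src_inr.1 h1
      have h4 := comp_src_inr.1 h2
      rw [← hS.mem_out_iff] at h3 h4
      obtain rfl := hS.1.eq c d
      exact iff_of_true (v.mem_step_out_out h3 h4) Relation.ReflTransGen.refl
  · rintro e e' (a | c) (b | d) h1 h2 h3 h4
    · obtain ⟨e₀, _, rfl, h5, h6⟩ := comp_edge_inl_inl h1 h3
      obtain ⟨e₁, _, rfl, h7, h8⟩ := comp_edge_inl_inl h2 h4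
      obtain rfl := hH.simple h5 h7 h6 h8
      rfl
    · obtain ⟨e₀, f₀, _, j, rfl, h5, h6, h7, h8⟩ := comp_edge_inl_inr h1 h3
      obtain ⟨e₁, f₁, _, j', rfl, h9, h10, h11, h12⟩ := comp_edge_inl_inr h2 h4
      obtain ⟨i, g1, s1, k1⟩ := key ⟨e₀, j, h5, h6, rfl⟩ ⟨f₀, _, h7, h8, rfl⟩
      obtain ⟨i', g2, s2, k2⟩ := key ⟨e₁, j', h9, h10, rfl⟩ ⟨f₁, _, h11, h12, rfl⟩
      have r1 := (hH.rel s1 s2).2 Relation.ReflTransGen.refl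
      have r2 := (hH.rel s2 s1).2 Relation.ReflTransGen.refl
      -- The two edges share a source, so `i` and `i'` are equivalent in `R`, and each is the least
      -- index of its class among the edges into the center.
      obtain rfl : i = i' := le_antisymm (k1.2 _ r1 rfl k2.1).2 (k2.2 _ r2 rfl k1.1).2
      rw [getElem?_eq_some_iff_idxOf n1] at g1 g2
      obtain rfl : j = j' := Fin.ext (g1.2.symm.trans g2.2)
      obtain rfl := (H'.out_unique j).unique h6 h10
      obtain rfl := (S'.in_unique _).unique h7 h11
      rfl
    · exact absurd ⟨e, h1, h3⟩ comp_not_adj_inr_inl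
    · exact absurd (comp_adj_inr_inr.1 ⟨e, h1, h3⟩) (hS'.1.not_adj _ _)
  · rintro (a | c) (b | d) h1 (x | y) h2 h3
    · exact hH.hasse (comp_adj_inl_inl.1 h1) x (comp_transGen_inl_inl.1 h2)
        (comp_transGen_inl_inl.1 h3)
    · exact comp_unit_not_transGen_inr hS'.1 h3
    -- If `x` were strictly between `a` and the new vertex, it would lie weakly below the source `b`
    -- of some kept edge, so `a` is strictly below `b`. Maximality of the source `a` puts `b` below
    -- `a` again, which is a cycle.
    · obtain ⟨j, hj, hjd⟩ := comp_adj_inl_inr.1 h1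
      obtain ⟨i, -, hi, hk⟩ := key hj hjd
      obtain ⟨j', b, hj', hjd', hxb⟩ := (comp_transGen_inl_inr hS'.1).1 h3
      obtain ⟨i', -, hi', hk'⟩ := key hj' hjd'
      have hab : Relation.TransGen H'.Adj a b := (comp_transGen_inl_inl.1 h2).trans_left hxb
      have hr := (hH.rel hi hi').2 ((hH.lt_iff _ _).1 hab).to_reflTransGen
      have hba := (hH.rel hi' hi).1 (hk.2 _ hr rfl hk'.1).1
      exact H.acyclic (φ a) (((hH.lt_iff _ _).1 hab).trans_left hba)
    · exact comp_unit_not_transGen_inr hS'.1 h3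
    · exact comp_not_adj_inr_inl h1
    · exact comp_not_adj_inr_inl h1
    · exact comp_unit_not_transGen_inr hS'.1 h2
    · exact comp_unit_not_transGen_inr hS'.1 h2

theorem Reduces.isomorphic {H H' : Slice T} {φ : H'.C ≃ H.C} {K : List ℕ}
    (h : Reduces H H' φ R K) : H'.closure.Isomorphic H.closure :=
  ⟨φ, h.label, fun a b => (h.le_iff a b).symm⟩

theorem Reduces.isSimple {H H' : Slice T} {φ : H'.C ≃ H.C} {K : List ℕ}
    (h : Reduces H H' φ R K) (hi : H'.ins = 0) (ho : H'.outs = 0) : H'.IsSimple := by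
  intro e e' h1 h2
  cases hs : H'.src e with
  | inl k => exact absurd k.2 (by omega)
  | inr a =>
    cases ht : H'.tgt e with
    | inr k => exact absurd k.2 (by omega)
    | inl b => exact h.simple hs (h1 ▸ hs) ht (h2 ▸ ht)

theorem Reduces.isTransitiveReduced {H H' : Slice T} {φ : H'.C ≃ H.C} {K : List ℕ}
    (h : Reduces H H' φ R K) (hi : H'.ins = 0) (ho : H'.outs = 0) :
    H'.IsTransitiveReduced := by
  intro e he
  cases hs : H'.src e with
  | inl k => exact absurd k.2 (by omega)
  | inr a =>
    cases ht : H'.tgt e with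
    | inr k => exact absurd k.2 (by omega)
    | inl b =>
      have hab := (he a b).2 (Relation.TransGen.single ⟨e, hs, ht⟩)
      have mono : ∀ x y, H'.AdjWithout e x y → H'.Adj x y :=
        fun x y ⟨e', _, h1, h2⟩ => ⟨e', h1, h2⟩
      -- A path from `a` to `b` avoiding `e` is either a single edge parallel to `e`, excluded by
      -- `simple`, or passes through a vertex strictly between, excluded by `hasse`.
      obtain ⟨x, ⟨e', hne, h1, h2⟩, hxb⟩ := Relation.TransGen.head'_iff.1 hab
      rcases Relation.reflTransGen_iff_eq_or_transGen.1 hxb with rfl | hxb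
      · exact hne (h.simple h1 hs h2 ht)
      · exact h.hasse ⟨e, hs, ht⟩ x (Relation.TransGen.single ⟨e', h1, h2⟩)
          (Relation.TransGen.mono mono _ _ hxb)

end

end Slice

/-! ### The slice graph of annotated slices -/

/-- A vertex of the transitive reduction of a slice graph: a position in the list of the vertices of
the slice graph, the code found there, a relation on the in-frontier, and a set of kept
out-frontier vertices. -/
abbrev Vertex (T : Type u) : Type u := ℕ × UnitSliceCode T × List (ℕ × ℕ) × List ℕ

namespace Vertex

/-- The kept in-frontier vertices. -/
def keptIn (x : Vertex T) : List ℕ := back x.2.1.2.1 x.2.1.2.2.2 x.2.2.1 x.2.2.2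

/-- The relation on the out-frontier. -/
def next (x : Vertex T) : List (ℕ × ℕ) := step x.2.1.2.2.1 x.2.1.2.2.2 x.2.2.1

/-- The code of the slice that consists of the kept edges. -/
def code (x : Vertex T) : UnitSliceCode T :=
  (x.2.1.1, x.keptIn.length, x.2.2.2.length, restrict x.2.1.2.2.2 x.keptIn x.2.2.2)

/-- The annotations of the vertices `x` and `y` match, and `E` has an edge between their
positions. -/
def Joined (E : List (ℕ × ℕ)) (x y : Vertex T) : Prop :=
  (x.1, y.1) ∈ E ∧ y.2.2.1 = x.next ∧ x.2.2.2 = y.keptIn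

instance (E : List (ℕ × ℕ)) (x y : Vertex T) : Decidable (Joined E x y) := by
  unfold Joined; infer_instance

end Vertex

/-- The candidates for the vertices of the transitive reduction at position `k`. -/
def verticesAt (l : List (UnitSliceCode T)) (k : ℕ) : List (Vertex T) :=
  l[k]?.toList.flatMap fun s => (subs (pairs s.2.1)).flatMap fun R =>
    (subs (List.range s.2.2.1)).map fun K => (k, s, R, K)

/-- The vertices of the transitive reduction. -/
def vertices (l : List (UnitSliceCode T)) : List (Vertex T) :=
  ((List.range l.length).flatMap (verticesAt l)).filter fun x =>
    decide (Good x.2.1.2.1 x.2.1.2.2.1 x.2.1.2.2.2 x.2.2.1 x.2.2.2)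

theorem mem_vertices {l : List (UnitSliceCode T)} {k : ℕ} {s : UnitSliceCode T}
    {R : List (ℕ × ℕ)} {K : List ℕ} : (k, s, R, K) ∈ vertices l ↔
      l[k]? = some s ∧ R.Sublist (pairs s.2.1) ∧ K.Sublist (List.range s.2.2.1) ∧
        Good s.2.1 s.2.2.1 s.2.2.2 R K := by
  simp only [vertices, verticesAt, List.mem_filter, List.mem_flatMap, List.mem_range,
    Option.mem_toList, mem_subs, List.mem_map, Prod.mk.injEq,
    decide_eq_true_eq]
  constructor
  · rintro ⟨⟨k', -, s', hs, R', hR, K', hK, rfl, rfl, rfl, rfl⟩, hg⟩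
    exact ⟨hs, hR, hK, hg⟩
  · rintro ⟨hs, hR, hK, hg⟩
    exact ⟨⟨k, (List.getElem?_eq_some_iff.1 hs).1, s, hs, R, hR, K, hK, rfl, rfl, rfl, rfl⟩, hg⟩

/-- The vertices of the transitive reduction at the positions `e.1` and `e.2` are joined. -/
def JoinedAt (c : SliceGraphCode T) (e : ℕ × ℕ) : Prop :=
  ∃ x ∈ (vertices c.1)[e.1]?.toList, ∃ y ∈ (vertices c.1)[e.2]?.toList, Vertex.Joined c.2 x y

instance (c : SliceGraphCode T) : DecidablePred (JoinedAt c) := fun _ => by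
  unfold JoinedAt; infer_instance

/-- The code of the transitive reduction of a slice graph. -/
def reduction (c : SliceGraphCode T) : SliceGraphCode T :=
  ((vertices c.1).map Vertex.code,
    (pairs (vertices c.1).length).filter fun e => decide (JoinedAt c e))

/-- All codes of the list have the edge list of a unit slice. -/
def ValidCodes (l : List (UnitSliceCode T)) : Prop :=
  ∀ s ∈ l, ValidEdges s.2.1 s.2.2.1 s.2.2.2

theorem ValidCodes.validEdges {l : List (UnitSliceCode T)} (hl : ValidCodes l) {x : Vertex T}
    (hx : x ∈ vertices l) :
    ValidEdges x.keptIn.length x.2.2.2.length (restrict x.2.1.2.2.2 x.keptIn x.2.2.2) := by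
  obtain ⟨k, s, R, K⟩ := x
  obtain ⟨hs, hR, hK, -⟩ := mem_vertices.1 hx
  exact (hl s (List.mem_of_getElem? hs)).restrict hK

/-- If an original frontier is empty, so is its restriction; otherwise `Good` provides a kept edge
between it and the center. -/
theorem isNondegenerate_of_describes_code {l : List (UnitSliceCode T)}
    {x : Vertex T} {S : Slice T} (hx : x ∈ vertices l) (hd : UnitSliceCode.Describes x.code S) :
    S.IsNondegenerate := by
  intro a
  obtain ⟨k, s, R, K⟩ := x
  obtain ⟨hs, hR, hK, hg⟩ := mem_vertices.1 hx
  have n2 : K.Nodup := List.nodup_range.sublist hK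
  constructor
  · intro hne
    rcases hg.1 with h0 | ⟨i, hi', hin⟩
    · refine absurd (hd.2.2.1.trans ?_) hne
      change (back s.2.1 _ _ _).length = 0
      rw [h0]
      rfl
    · obtain ⟨e, j, h1, h2, -⟩ := (UnitSliceCode.Describes.mem_in_iff hd a).1
        ((mem_restrict_in back_nodup).2
          ⟨i, (getElem?_eq_some_iff_idxOf back_nodup).2 ⟨hi', rfl⟩, hin⟩)
      exact ⟨e, j, h1, h2⟩
  · intro hne
    rcases hg.2 with h0 | ⟨i, hi', hin⟩
    · refine absurd (hd.2.2.2.1.trans ?_) hne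
      change K.length = 0
      rw [h0] at hK
      simpa using hK
    · obtain ⟨e, j, h1, h2, -⟩ := (UnitSliceCode.Describes.mem_out_iff hd a).1
        ((mem_restrict_out n2).2 ⟨i, (getElem?_eq_some_iff_idxOf n2).2 ⟨hi', rfl⟩, hin⟩)
      exact ⟨e, j, h1, h2⟩

/-- The transitive reduction of the slice graph described by `c`. -/
def reductionGraph (c : SliceGraphCode T) (hc : ValidCodes c.1) : SliceGraph T where
  V := Fin (vertices c.1).length
  finite_V := inferInstance
  Edge k l := Vertex.Joined c.2 ((vertices c.1).get k) ((vertices c.1).get l)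
  slice k := unitSlice _ _ _ _ (hc.validEdges ((vertices c.1).get_mem k))
  unit _ := ⟨(), fun _ => rfl⟩
  nondegenerate k := isNondegenerate_of_describes_code ((vertices c.1).get_mem k)
    (describes_unitSlice _ _ _ _ (hc.validEdges ((vertices c.1).get_mem k)))
  composable _ _ h := congrArg List.length h.2.2

theorem describes_reductionGraph (c : SliceGraphCode T) (hc : ValidCodes c.1) :
    SliceGraphCode.Describes (reduction c) (reductionGraph c hc) := by
  refine ⟨finCongr (by simp [reduction]), fun k => ?_, fun k l => ?_⟩
  · have : (reduction c).1.get k = Vertex.code ((vertices c.1).get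
        (finCongr (by simp [reduction]) k)) := List.getElem_map _
    rw [this]
    exact describes_unitSlice _ _ _ _ (hc.validEdges (List.get_mem _ _))
  · have hk : (k : ℕ) < (vertices c.1).length := by simpa [reduction] using k.2
    have hl : (l : ℕ) < (vertices c.1).length := by simpa [reduction] using l.2
    simp only [reduction, JoinedAt, List.mem_filter, mem_pairs, hk, hl, true_and, decide_eq_true_eq,
      List.getElem?_eq_getElem, Option.toList_some, List.mem_singleton, exists_eq_left]
    rfl

/-! ### Correctness: projecting and lifting walks -/

section correctness

variable {c : SliceGraphCode T} {G : SliceGraph T} {b : Fin c.1.length ≃ G.V}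

/-- The vertex of the original slice graph below a vertex of the transitive reduction. -/
def base (b : Fin c.1.length ≃ G.V) (k : Fin (vertices c.1).length) : G.V :=
  b ⟨((vertices c.1).get k).1,
    (List.getElem?_eq_some_iff.1 (mem_vertices.1 ((vertices c.1).get_mem k)).1).1⟩

theorem base_describes (hb : ∀ k, UnitSliceCode.Describes (c.1.get k) (G.slice (b k)))
    (k : Fin (vertices c.1).length) :
    UnitSliceCode.Describes ((vertices c.1).get k).2.1 (G.slice (base b k)) := by
  have h := (List.getElem?_eq_some_iff.1 (mem_vertices.1 ((vertices c.1).get_mem k)).1)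
  rw [← h.choose_spec]
  exact hb _

theorem validCodes_of_describes
    (hb : ∀ k, UnitSliceCode.Describes (c.1.get k) (G.slice (b k))) : ValidCodes c.1 := by
  intro s hs
  obtain ⟨k, rfl⟩ := List.mem_iff_get.1 hs
  exact (hb k).validEdges

/-- Induction on the walk from its end, matching the left bracketing of compositions. The joining
condition makes the `R` and `K` of adjacent vertices fit the hypotheses of `Slice.Reduces.comp`.
Only the start of the walk has to be initial. -/
theorem exists_reduces (hb : ∀ k, UnitSliceCode.Describes (c.1.get k) (G.slice (b k)))
    (hE : ∀ k l, G.Edge (b k) (b l) ↔ ((k : ℕ), (l : ℕ)) ∈ c.2)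
    (hc : ValidCodes c.1) (w : List (Fin (vertices c.1).length)) (hw : w ≠ [])
    (hch : w.IsChain (reductionGraph c hc).Edge)
    (hini : ((reductionGraph c hc).slice (w.head hw)).IsInitial) :
    ∃ H H' φ, Slice.IsCompositionOf (w.map fun k => G.slice (base b k)) H ∧
      Slice.IsCompositionOf (w.map (reductionGraph c hc).slice) H' ∧ H'.ins = 0 ∧
      H.outs = (G.slice (base b (w.getLast hw))).outs ∧
      Slice.Reduces H H' φ ((vertices c.1).get (w.getLast hw)).next
        ((vertices c.1).get (w.getLast hw)).2.2.2 := by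
  induction w using List.reverseRecOn with
  | nil => exact absurd rfl hw
  | append_singleton w k ih =>
    have hk := (vertices c.1).get_mem k
    have hd := base_describes hb k
    have hd' : UnitSliceCode.Describes ((vertices c.1).get k).code
        ((reductionGraph c hc).slice k) :=
      describes_unitSlice _ _ _ _ (hc.validEdges hk)
    simp only [List.getLast_append_singleton]
    rcases eq_or_ne w [] with rfl | hw0
    · refine ⟨_, _, ?_, .single _, .single _, hini, rfl, ?_⟩
      · exact Slice.unitEquiv hd.1 hd'.1
      have hini' : ((vertices c.1).get k).keptIn.length = 0 := hini
      generalize (vertices c.1).get k = x at *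
      obtain ⟨k', ⟨t, p, q, L⟩, R, K⟩ := x
      obtain ⟨hs, hR, hK, hg⟩ := mem_vertices.1 hk
      -- By `Good`, a non-empty in-frontier would retain a kept edge, so an empty restricted
      -- in-frontier was empty from the start.
      have hp : p = 0 := by
        rcases hg.1 with h0 | ⟨i, hi, -⟩
        · exact h0
        · exact absurd (List.length_pos_of_mem hi) (by simpa [Vertex.keptIn] using hini')
      -- `pairs 0` is empty, so at an initial vertex the annotation `R` carries no choice.
      obtain rfl : R = [] := by
        simp only [hp] at hR
        simpa [pairs] using hR
      exact Slice.reduces_unit hd hd' hK hp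
    · obtain ⟨hch0, -, hlast⟩ := List.isChain_append.1 hch
      have hj := hlast _ (List.getLast_mem_getLast? hw0) k rfl
      rw [List.head_append_of_ne_nil hw0] at hini
      obtain ⟨H, H', φ, h1, h2, h3, h4, h5⟩ := ih hw0 hch0 hini
      have hcomp : H.Composable (G.slice (base b k)) :=
        h4.trans (G.composable _ _ ((hE _ _).2 hj.1))
      have hcomp' : H'.Composable ((reductionGraph c hc).slice k) :=
        h5.outs'.trans (congrArg List.length hj.2.2)
      refine ⟨H.comp _ hcomp, H'.comp _ hcomp', Equiv.sumCongr φ (Slice.unitEquiv hd.1 hd'.1),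
        ?_, ?_, h3, rfl, ?_⟩
      · rw [List.map_append]
        exact h1.snoc hcomp
      · have hmap : (w ++ [k]).map (reductionGraph c hc).slice =
            w.map (reductionGraph c hc).slice ++ [(reductionGraph c hc).slice k] :=
          List.map_append
        exact hmap ▸ h2.snoc hcomp'
      rw [← hj.2.1, hj.2.2] at h5
      clear hlast hch hj
      generalize (vertices c.1).get k = x at *
      obtain ⟨k', ⟨t, p, q, L⟩, R, K⟩ := x
      obtain ⟨hs, hR, hK, hg⟩ := mem_vertices.1 hk
      exact Slice.Reduces.comp h5 hd hd' hK hcomp hcomp'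

/-- `R` runs forward and is prescribed at the head of the walk; `K` runs backward and comes from the
lift of the tail. `MaxKept` is part of the conclusion because it is what shows that the next vertex
to the left satisfies `Good`. -/
theorem exists_lift (hb : ∀ k, UnitSliceCode.Describes (c.1.get k) (G.slice (b k)))
    (hE : ∀ k l, G.Edge (b k) (b l) ↔ ((k : ℕ), (l : ℕ)) ∈ c.2)
    (hc : ValidCodes c.1) (w : List G.V) (v : G.V) (R : List (ℕ × ℕ))
    (hch : (v :: w).IsChain G.Edge) (hfin : (G.slice ((v :: w).getLast (by simp))).IsFinal)
    (hR : R.Sublist (pairs (G.slice v).ins)) (hpre : PreorderBelow (G.slice v).ins R) :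
    ∃ (k : Fin (vertices c.1).length) (w' : List (Fin (vertices c.1).length)),
      (k :: w').IsChain (reductionGraph c hc).Edge ∧ base b k = v ∧ w'.map (base b) = w ∧
      ((vertices c.1).get k).2.2.1 = R ∧
      ((reductionGraph c hc).slice ((k :: w').getLast (by simp))).IsFinal ∧
      MaxKept (G.slice v).ins R ((vertices c.1).get k).keptIn := by
  -- One vertex of the lift: given `R` and a `K` that meets every maximal class at the out-frontier,
  -- the annotated slice is an admitted vertex, and the property `MaxKept` passes to its
  -- in-frontier.
  have main : ∀ (v : G.V) (R : List (ℕ × ℕ)) (K : List ℕ), R.Sublist (pairs (G.slice v).ins) →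
      PreorderBelow (G.slice v).ins R → K.Sublist (List.range (G.slice v).outs) →
      (∀ L, (c.1.get (b.symm v)).2.2.2 = L →
        MaxKept (G.slice v).outs (step (G.slice v).outs L R) K) →
      ∃ k : Fin (vertices c.1).length, base b k = v ∧
        (vertices c.1).get k = ((b.symm v : ℕ), c.1.get (b.symm v), R, K) ∧
        MaxKept (G.slice v).ins R ((vertices c.1).get k).keptIn := by
    intro v R K hR hpre hK hmax
    have hd := hb (b.symm v)
    rw [Equiv.apply_symm_apply] at hd
    have hx : ((b.symm v : ℕ), c.1.get (b.symm v), R, K) ∈ vertices c.1 ∧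
        MaxKept (G.slice v).ins R
          (Vertex.keptIn ((b.symm v : ℕ), c.1.get (b.symm v), R, K)) := by
      have hg : c.1[(b.symm v : ℕ)]? = some (c.1.get (b.symm v)) := by simp
      rw [mem_vertices, hg]
      clear hg
      generalize c.1.get (b.symm v) = s at *
      obtain ⟨t, p, q, L⟩ := s
      have hp : (G.slice v).ins = p := hd.2.2.1
      have hq : (G.slice v).outs = q := hd.2.2.2.1
      have hm := hmax L rfl
      obtain ⟨a, -⟩ := id hd.1
      obtain ⟨n1, n2⟩ := G.nondegenerate v a
      rw [hp] at hR hpre ⊢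
      rw [hq] at hK hm
      refine ⟨⟨rfl, hR, hK, hm.good hd.validEdges hpre ?_ ?_⟩, hm.back hd.validEdges hpre⟩
      · intro h0
        obtain ⟨e, i, h1, h2⟩ := n1 (by rwa [hp])
        exact ⟨i, (hd.mem_in_iff a).2 ⟨e, i, h1, h2, rfl⟩⟩
      · intro h0
        obtain ⟨e, i, h1, h2⟩ := n2 (by rwa [hq])
        exact ⟨i, (hd.mem_out_iff a).2 ⟨e, i, h1, h2, rfl⟩⟩
    obtain ⟨k, hk⟩ := List.mem_iff_get.1 hx.1
    refine ⟨k, ?_, hk, by rw [hk]; exact hx.2⟩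
    have : b (b.symm v) = v := b.apply_symm_apply v
    rw [← this]
    unfold base
    congr 1
    exact Fin.ext (congrArg Prod.fst hk)
  induction w generalizing v R with
  | nil =>
    have h0 : (G.slice v).outs = 0 := hfin
    -- A final slice has no out-frontier, so `K = []` satisfies `MaxKept` vacuously.
    obtain ⟨k, h1, h2, h3⟩ := main v R [] hR hpre (List.nil_sublist _)
      (fun L _ i hi => by omega)
    refine ⟨k, [], List.isChain_singleton _, h1, rfl, by rw [h2], ?_, h3⟩
    change ((vertices c.1).get k).2.2.2.length = 0
    rw [h2]
    rfl
  | cons v' w ih =>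
    rw [List.isChain_cons_cons] at hch
    have hq : (G.slice v).outs = (G.slice v').ins := G.composable _ _ hch.1
    have hd := hb (b.symm v)
    rw [Equiv.apply_symm_apply] at hd
    have hpre' : PreorderBelow (G.slice v).outs
        (step (G.slice v).outs (c.1.get (b.symm v)).2.2.2 R) := by
      generalize c.1.get (b.symm v) = s at hd
      obtain ⟨t, p, q, L⟩ := s
      have hp : (G.slice v).ins = p := hd.2.2.1
      have hq : (G.slice v).outs = q := hd.2.2.2.1
      rw [hp] at hpre
      rw [hq]
      exact hpre.step hd.validEdges
    obtain ⟨k', w', i1, i2, i3, i4, i5, i6⟩ :=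
      ih v' (step (G.slice v).outs (c.1.get (b.symm v)).2.2.2 R) hch.2
        (by simpa using hfin) (hq ▸ step_sublist) (hq ▸ hpre')
    have hd' := base_describes hb k'
    rw [i2] at hd'
    obtain ⟨k, h1, h2, h3⟩ := main v R ((vertices c.1).get k').keptIn hR hpre
      (by rw [hq, hd'.2.2.1]; exact back_sublist)
      (fun L hL => by rw [← hL]; rw [← hq] at i6; exact i6)
    refine ⟨k, k' :: w', List.isChain_cons_cons.2 ⟨?_, i1⟩, h1, by simp [i2, i3], by rw [h2],
      by simpa using i5, h3⟩
    refine ⟨?_, ?_, by rw [h2]⟩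
    · have := (hE _ _).1 (show G.Edge (base b k) (base b k') by rw [h1, i2]; exact hch.1)
      exact this
    · rw [i4, h2, hd.2.2.2.1]
      rfl

theorem reductionGraph_correct (hb : ∀ k, UnitSliceCode.Describes (c.1.get k) (G.slice (b k)))
    (hE : ∀ k l, G.Edge (b k) (b l) ↔ ((k : ℕ), (l : ℕ)) ∈ c.2) (hc : ValidCodes c.1) :
    (reductionGraph c hc).IsHasseDiagramGenerator ∧
      (reductionGraph c hc).poLanguage = G.poLanguage := by
  have trans : ∀ {P Q S : LabeledPO T}, P.Isomorphic Q → Q.Isomorphic S → P.Isomorphic S := by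
    rintro P Q S ⟨φ, h1, h2⟩ ⟨ψ, h3, h4⟩
    exact ⟨φ.trans ψ, fun x => (h3 _).trans (h1 x), fun x y => (h4 _ _).trans (h2 x y)⟩
  have symm : ∀ {P Q : LabeledPO T}, P.Isomorphic Q → Q.Isomorphic P := by
    rintro P Q ⟨φ, h1, h2⟩
    exact ⟨φ.symm, fun x => by rw [← h1, φ.apply_symm_apply],
      fun x y => by rw [← h2, φ.apply_symm_apply, φ.apply_symm_apply]⟩
  have outs : ∀ {H H' : Slice T} {φ R K}, Slice.Reduces H H' φ R K → K.length = 0 →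
      H'.outs = 0 := fun h h0 => h.outs'.trans h0
  have edge : ∀ {k l}, (reductionGraph c hc).Edge k l → G.Edge (base b k) (base b l) :=
    fun h => (hE _ _).2 h.1
  refine ⟨?_, Set.Subset.antisymm ?_ ?_⟩
  · rintro H' ⟨_, ⟨w, hw, hch, hini, hfin, rfl⟩, hH'⟩
    obtain ⟨H, H'', φ, h1, h2, h3, h4, h5⟩ := exists_reduces hb hE hc w hw hch hini
    obtain rfl := h2.unique hH'
    exact ⟨h5.isSimple h3 (outs h5 hfin), h5.isTransitiveReduced h3 (outs h5 hfin)⟩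
  · rintro P ⟨H', ⟨_, ⟨(w : List (Fin (vertices c.1).length)), hw, hch, hini, hfin, rfl⟩, hH'⟩, hP⟩
    obtain ⟨H, H'', φ, h1, h2, h3, h4, h5⟩ := exists_reduces hb hE hc w hw hch hini
    obtain rfl := h2.unique hH'
    have hw' : w.map (base b) ≠ [] := fun h => hw (List.map_eq_nil_iff.1 h)
    have hcode : ∀ k, Good ((vertices c.1).get k).2.1.2.1 ((vertices c.1).get k).2.1.2.2.1
        ((vertices c.1).get k).2.1.2.2.2 ((vertices c.1).get k).2.2.1
        ((vertices c.1).get k).2.2.2 := fun k => (mem_vertices.1 (List.get_mem _ k)).2.2.2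
    refine ⟨H, ⟨_, ⟨w.map (base b), hw', ?_, ?_, ?_, rfl⟩, ?_⟩, trans hP h5.isomorphic⟩
    · exact (List.isChain_map _).2 (hch.imp fun _ _ h => edge h)
    · rw [List.head_map]
      refine (base_describes hb _).2.2.1.trans ?_
      -- An initial vertex of the reduction lies over an initial vertex: `Good` would keep an edge
      -- of a non-empty in-frontier. The same argument is used below for final vertices.
      rcases (hcode (w.head hw)).1 with h0 | ⟨i, hi, -⟩
      · exact h0
      · exact absurd (List.length_pos_of_mem hi) (Nat.not_lt.2 (le_of_eq hini))
    · rw [List.getLast_map]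
      refine (base_describes hb _).2.2.2.1.trans ?_
      rcases (hcode (w.getLast hw)).2 with h0 | ⟨i, hi, -⟩
      · exact h0
      · exact absurd (List.length_pos_of_mem hi) (Nat.not_lt.2 (le_of_eq hfin))
    · rw [List.map_map]
      exact h1
  · rintro P ⟨H, ⟨_, ⟨w, hw, hch, hini, hfin, rfl⟩, hH⟩, hP⟩
    obtain ⟨v, w, rfl⟩ := List.exists_cons_of_ne_nil hw
    have h0 : (G.slice v).ins = 0 := hini
    -- The lift starts with the empty relation, the only one on the empty in-frontier of an initial
    -- slice.
    obtain ⟨k, w', i1, rfl, rfl, i4, i5, i6⟩ := exists_lift hb hE hc w v [] hch hfin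
      (List.nil_sublist _) (h0 ▸ preorderBelow_zero)
    have hini' : ((reductionGraph c hc).slice k).IsInitial := by
      have hp := (base_describes hb k).2.2.1.symm.trans h0
      change (back _ _ _ _).length = 0
      rw [hp]
      rfl
    obtain ⟨H₁, H', φ, h1, h2, h3, h4, h5⟩ :=
      exists_reduces hb hE hc (k :: w') (by simp) i1 hini'
    have h1' : Slice.IsCompositionOf ((base b k :: w'.map (base b)).map G.slice) H₁ := by
      simpa [Function.comp_def] using h1
    obtain rfl := h1'.unique hH
    exact ⟨H', ⟨_, ⟨k :: w', by simp, i1, hini', i5, rfl⟩, h2⟩, trans hP (symm h5.isomorphic)⟩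

end correctness

theorem reduction_correct {c : SliceGraphCode T} {G : SliceGraph T} (h : c.Describes G) :
    ∃ H : SliceGraph T, (reduction c).Describes H ∧ H.IsHasseDiagramGenerator ∧
      H.poLanguage = G.poLanguage := by
  obtain ⟨b, hb, hE⟩ := h
  have hc := validCodes_of_describes hb
  exact ⟨reductionGraph c hc, describes_reductionGraph c hc, reductionGraph_correct hb hE hc⟩

end SliceTheory

-- Primitive recursiveness of the reduction

attribute [fun_prop] Primrec
attribute [fun_prop] Primrec.id Primrec.const Primrec.comp Primrec.fst Primrec.snd Primrec.pair
  Primrec.list_length Primrec.option_some Primrec.optionToList Primrec.list_range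

namespace SliceTheory

section primrec

variable {α β γ : Type*} [Primcodable α] [Primcodable β] [Primcodable γ]

/-- Bounded quantification over a list that may depend on the parameter; with its universal
counterpart it handles the quantifiers in the definition of the reduction. -/
theorem primrecPred_exists_mem {f : α → List β} {P : α → β → Prop} (hf : Primrec f)
    (hP : PrimrecPred fun x : α × β => P x.1 x.2) : PrimrecPred fun a => ∃ b ∈ f a, P a b :=
  (PrimrecRel.exists_mem_list (R := fun b a => P a b)
    (hP.comp (Primrec.snd.pair Primrec.fst))).comp hf Primrec.id

theorem primrecPred_forall_mem {f : α → List β} {P : α → β → Prop} (hf : Primrec f)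
    (hP : PrimrecPred fun x : α × β => P x.1 x.2) : PrimrecPred fun a => ∀ b ∈ f a, P a b :=
  (PrimrecRel.forall_mem_list (R := fun b a => P a b)
    (hP.comp (Primrec.snd.pair Primrec.fst))).comp hf Primrec.id

theorem primrecPred_imp {P Q : α → Prop} (hP : PrimrecPred P) (hQ : PrimrecPred Q) :
    PrimrecPred fun a => P a → Q a :=
  (hP.not.or hQ).of_eq fun _ => imp_iff_not_or.symm

theorem primrecPred_eq {f g : α → β} (hf : Primrec f) (hg : Primrec g) :
    PrimrecPred fun a => f a = g a :=
  Primrec.eq.comp hf hg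

theorem primrecPred_mem {f : α → List β} {g : α → β} (hg : Primrec g) (hf : Primrec f) :
    PrimrecPred fun a => g a ∈ f a :=
  (primrecPred_exists_mem (P := fun a b => b = g a) hf
    (primrecPred_eq (by fun_prop) (by fun_prop))).of_eq fun _ => by simp

theorem primrec_filter {f : α → List β} {P : α → β → Prop} [∀ a, DecidablePred (P a)]
    (hf : Primrec f) (hP : PrimrecPred fun x : α × β => P x.1 x.2) :
    Primrec fun a => (f a).filter fun b => decide (P a b) :=
  (PrimrecRel.listFilter (R := fun b a => P a b)
    (hP.comp (Primrec.snd.pair Primrec.fst))).comp hf Primrec.id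

theorem primrec_map {f : α → List β} {g : α → β → γ} (hf : Primrec f)
    (hg : Primrec fun x : α × β => g x.1 x.2) : Primrec fun a => (f a).map (g a) :=
  Primrec.list_map hf hg

theorem primrec_flatMap {f : α → List β} {g : α → β → List γ} (hf : Primrec f)
    (hg : Primrec fun x : α × β => g x.1 x.2) : Primrec fun a => (f a).flatMap (g a) :=
  Primrec.list_flatMap hf hg

theorem primrec_pairs : Primrec pairs :=
  primrec_flatMap (by fun_prop) (primrec_map (by fun_prop) (by fun_prop))

theorem primrec_subs : Primrec (subs (α := α)) := by
  refine Primrec.list_foldr (α := List α) (σ := List (List α))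
    (h := fun _ x => x.2 ++ x.2.map (List.cons x.1)) Primrec.id
    (Primrec.const _) ?_
  refine Primrec.list_append.comp₂ (Primrec.snd.comp Primrec.snd) ?_
  exact primrec_map (by fun_prop)
    (Primrec.list_cons.comp (by fun_prop) (by fun_prop))

theorem primrecPred_keepIn : PrimrecPred fun x : (EdgeList × List (ℕ × ℕ)) × ℕ =>
    KeepIn x.1.1 x.1.2 x.2 := by
  refine (primrecPred_mem (by fun_prop) (by fun_prop)).and
    (primrecPred_forall_mem (by fun_prop) (primrecPred_imp
      (primrecPred_eq (by fun_prop) (by fun_prop)) (primrecPred_imp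
        (primrecPred_mem (by fun_prop) (by fun_prop)) ?_)))
  exact (primrecPred_mem (by fun_prop) (by fun_prop)).and
    (Primrec.nat_le.comp (by fun_prop) (by fun_prop))

@[fun_prop]
theorem primrec_back {f : α → ℕ} {g : α → EdgeList} {h : α → List (ℕ × ℕ)} {k : α → List ℕ}
    (hf : Primrec f) (hg : Primrec g) (hh : Primrec h) (hk : Primrec k) :
    Primrec fun a => back (f a) (g a) (h a) (k a) := by
  refine primrec_filter (P := fun a i => KeepIn (g a) (h a) i ∨ ∃ j ∈ k a, (some i, some j) ∈ g a)
    (by fun_prop) (PrimrecPred.or ?_ ?_)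
  · exact primrecPred_keepIn.comp (f := fun x : α × ℕ => ((g x.1, h x.1), x.2)) (by fun_prop)
  · exact primrecPred_exists_mem (by fun_prop) (primrecPred_mem (by fun_prop) (by fun_prop))

theorem primrecPred_stepRel : PrimrecPred fun x : (EdgeList × List (ℕ × ℕ)) × (ℕ × ℕ) =>
    StepRel x.1.1 x.1.2 x.2 := by
  refine ((primrecPred_mem (by fun_prop) (by fun_prop)).and
    (primrecPred_mem (by fun_prop) (by fun_prop))).or
    (primrecPred_exists_mem (by fun_prop) ((primrecPred_mem (by fun_prop) (by fun_prop)).and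
      ((primrecPred_mem (by fun_prop) (by fun_prop)).or
        ((primrecPred_mem (by fun_prop) (by fun_prop)).and
          (primrecPred_mem (by fun_prop) (by fun_prop))))))

@[fun_prop]
theorem primrec_step {f : α → ℕ} {g : α → EdgeList} {h : α → List (ℕ × ℕ)}
    (hf : Primrec f) (hg : Primrec g) (hh : Primrec h) :
    Primrec fun a => step (f a) (g a) (h a) :=
  primrec_filter (P := fun a x => StepRel (g a) (h a) x) (primrec_pairs.comp hf)
    (primrecPred_stepRel.comp (f := fun x : α × ℕ × ℕ => ((g x.1, h x.1), x.2)) (by fun_prop))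

@[fun_prop]
theorem primrec_restrict {g : α → EdgeList} {h k : α → List ℕ}
    (hg : Primrec g) (hh : Primrec h) (hk : Primrec k) :
    Primrec fun a => restrict (g a) (h a) (k a) := by
  have idx : ∀ {f : α × (Option ℕ × Option ℕ) → Option ℕ} {l : α → List ℕ}, Primrec f →
      Primrec l → Primrec fun x : α × (Option ℕ × Option ℕ) =>
        (f x).map fun i => (l x.1).idxOf i :=
    fun hf hl => Primrec.option_map hf (Primrec.list_idxOf.comp (by fun_prop) (by fun_prop))
  refine primrec_map (primrec_filter (P := fun a (x : Option ℕ × Option ℕ) =>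
    (∀ i ∈ x.1.toList, i ∈ h a) ∧ ∀ j ∈ x.2.toList, j ∈ k a) hg (PrimrecPred.and ?_ ?_)) ?_
  · exact primrecPred_forall_mem (by fun_prop) (primrecPred_mem (by fun_prop) (by fun_prop))
  · exact primrecPred_forall_mem (by fun_prop) (primrecPred_mem (by fun_prop) (by fun_prop))
  · exact (idx (by fun_prop) hh).pair (idx (by fun_prop) hk)

variable {T : Type*} [Primcodable T]

@[fun_prop]
theorem primrec_keptIn : Primrec (Vertex.keptIn (T := T)) := by
  unfold Vertex.keptIn
  fun_prop

@[fun_prop]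
theorem primrec_next : Primrec (Vertex.next (T := T)) := by
  unfold Vertex.next
  fun_prop

@[fun_prop]
theorem primrec_code : Primrec (Vertex.code (T := T)) := by
  unfold Vertex.code
  fun_prop

theorem primrecPred_joined : PrimrecPred fun x : List (ℕ × ℕ) × Vertex T × Vertex T =>
    Vertex.Joined x.1 x.2.1 x.2.2 := by
  exact (primrecPred_mem (by fun_prop) (by fun_prop)).and
    ((primrecPred_eq (by fun_prop) (by fun_prop)).and
      (primrecPred_eq (by fun_prop) (by fun_prop)))

theorem primrecPred_good : PrimrecPred fun x : Vertex T =>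
    Good x.2.1.2.1 x.2.1.2.2.1 x.2.1.2.2.2 x.2.2.1 x.2.2.2 := by
  refine ((primrecPred_eq (by fun_prop) (by fun_prop)).or ?_).and
    ((primrecPred_eq (by fun_prop) (by fun_prop)).or ?_)
  · exact primrecPred_exists_mem (by fun_prop) (primrecPred_mem (by fun_prop) (by fun_prop))
  · exact primrecPred_exists_mem (by fun_prop) (primrecPred_mem (by fun_prop) (by fun_prop))

theorem primrec_verticesAt : Primrec fun x : List (UnitSliceCode T) × ℕ =>
    verticesAt x.1 x.2 := by
  refine primrec_flatMap
    (Primrec.optionToList.comp (Primrec.list_getElem?.comp (by fun_prop) (by fun_prop))) ?_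
  refine primrec_flatMap (primrec_subs.comp (primrec_pairs.comp (by fun_prop))) ?_
  exact primrec_map (primrec_subs.comp (by fun_prop)) (by fun_prop)

theorem primrec_vertices : Primrec (vertices (T := T)) := by
  unfold vertices
  refine primrec_filter (P := fun _ x => Good _ _ _ _ _) ?_ (primrecPred_good.comp Primrec.snd)
  exact primrec_flatMap (by fun_prop) primrec_verticesAt

theorem primrecPred_joinedAt : PrimrecPred fun x : SliceGraphCode T × (ℕ × ℕ) =>
    JoinedAt x.1 x.2 := by
  have get : ∀ {α : Type _} [Primcodable α] {f : α → SliceGraphCode T} {g : α → ℕ},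
      Primrec f → Primrec g → Primrec fun a => (vertices (f a).1)[g a]?.toList :=
    fun hf hg => Primrec.optionToList.comp
      (Primrec.list_getElem?.comp (primrec_vertices.comp (Primrec.fst.comp hf)) hg)
  refine primrecPred_exists_mem (get Primrec.fst (by fun_prop))
    (primrecPred_exists_mem (get (by fun_prop) (by fun_prop)) ?_)
  exact primrecPred_joined.comp
    (f := fun x : ((SliceGraphCode T × (ℕ × ℕ)) × Vertex T) × Vertex T =>
      (x.1.1.1.2, x.1.2, x.2)) (by fun_prop)

theorem primrec_reduction : Primrec (reduction (T := T)) := by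
  have hv : Primrec fun c : SliceGraphCode T => vertices c.1 := primrec_vertices.comp Primrec.fst
  have h₁ : Primrec fun c : SliceGraphCode T => (vertices c.1).map Vertex.code :=
    primrec_map hv (primrec_code.comp Primrec.snd)
  have h₂ : Primrec fun c : SliceGraphCode T =>
      (pairs (vertices c.1).length).filter fun e => decide (JoinedAt c e) :=
    primrec_filter (primrec_pairs.comp (Primrec.list_length.comp hv)) primrecPred_joinedAt
  exact h₁.pair h₂

end primrec

end SliceTheory

/-- Every slice graph has a Hasse diagram generator with the same partial order language, and for
an effectively given set of events some algorithm computes one from the slice graph. -/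
theorem theorem2 (T : Type u) :
    (∀ G : SliceTheory.SliceGraph T, ∃ H : SliceTheory.SliceGraph T,
      H.IsHasseDiagramGenerator ∧ H.poLanguage = G.poLanguage) ∧
    (∀ [Primcodable T], ∃ f : SliceTheory.SliceGraphCode T → SliceTheory.SliceGraphCode T,
      Computable f ∧
      ∀ (c : SliceTheory.SliceGraphCode T) (G : SliceTheory.SliceGraph T), c.Describes G →
        ∃ H : SliceTheory.SliceGraph T, SliceTheory.SliceGraphCode.Describes (f c) H ∧
          H.IsHasseDiagramGenerator ∧ H.poLanguage = G.poLanguage) := by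
  refine ⟨fun G => ?_, fun {_} => ⟨SliceTheory.reduction,
    SliceTheory.primrec_reduction.to_comp, fun c G h => SliceTheory.reduction_correct h⟩⟩
  obtain ⟨c, hc⟩ := SliceTheory.exists_sliceGraphCode G
  obtain ⟨H, -, hH⟩ := SliceTheory.reduction_correct hc
  exact ⟨H, hH⟩
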